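/- Let $A=\mathbb C^{d_A}$ with $d_A\ge 1$ and $B=\mathbb C^{d_B}$. A non-commutative bipartite graph is a subspace $K$ of the linear maps $A\to B$ that is the linear span of the Choi--Kraus operators $E_k$ ($\sum_k E_k^\dagger E_k=\mathbb 1_A$) of some quantum channel $\mathcal N:\mathcal L(A)\to\mathcal L(B)$, $\mathcal N(\rho)=\sum_k E_k\rho E_k^\dagger$. Let $P=P_{AB}$ be the projection onto the support of the Choi--Jamiołkowski matrix $J_{AB}=\sum_{i,j}|i\rangle\langle j|\otimes\mathcal N(|i\rangle\langle j|)$, that is, onto $\{\sum_a |a\rangle\otimes E|a\rangle : E\in K\}$, so that $P$ depends only on $K$; put $P_B=\mathrm{tr}_A P_{AB}$, and let $\|\cdot\|_\infty$ be the operator norm. Define $$\Upsilon(K)=\max\{\mathrm{tr}\,S_A : 0\le U_{AB}\le S_A\otimes\mathbb 1_B,\ \mathrm{tr}_A U_{AB}=\mathbb 1_B,\ \mathrm{tr}\,P_{AB}(S_A\otimes\mathbb 1_B-U_{AB})=0\},$$ $$\widehat\Upsilon(K)=\max\{\mathrm{tr}\,S_A : 0\le U_{AB}\le S_A\otimes\mathbb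 1_B,\ \mathrm{tr}_A U_{AB}\le\mathbb 1_B,\ \mathrm{tr}\,P_{AB}(S_A\otimes\mathbb 1_B-U_{AB})=0\},$$ $$\mathsf A(K)=\max\{\mathrm{tr}\,S_A : S_A\ge 0,\ \mathrm{tr}_A P_{AB}(S_A\otimes\mathbb 1_B)\le\mathbb 1_B\},\qquad C_{0,\mathrm{NS}}(K)=\sup_{n\ge1}\tfrac1n\log_2\Upsilon(K^{\otimes n}).$$ Then the following are equivalent: (i) $C_{0,\mathrm{NS}}(K)>0$; (ii) $\mathsf A(K)>1$; (iii) $P_B<d_A\mathbb 1_B$, i.e. $d_A\mathbb 1_B-P_B$ is positive definite; (iv) $\mathrm{tr}_A(\mathbb 1_{AB}-P_{AB})$ is positive definite; (v) $\widehat\Upsilon(K)>1$. Moreover, $$C_{0,\mathrm{NS}}(K)\ \ge\ \log_2\widehat\Upsilon(K)\ \ge\ \log_2\frac{d_A}{\|P_B\|_\infty},\qquad \widehat\Upsilon(K)\ge\frac{d_A}{\|P_B\|_\infty},\qquad \mathsf A(K)\ge\frac{d_A}{\|P_B\|_\infty}.$$ Finally, $\frac{d_A}{\|P_B\|_\infty}=\mathsf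 A(K_s)$, where $K_s$ is the non-commutative bipartite graph of the cq-channel with $d_A^2$ inputs $m$ and output states $\frac1{d_A}(U_m\otimes\mathbb 1_B)J_{AB}(U_m\otimes\mathbb 1_B)^\dagger$, with $U_m$ the $d_A^2$ generalized Pauli matrices $X^jZ^k$ on $A$. -/

import Mathlib

open scoped Matrix Kronecker ComplexOrder

noncomputable section

namespace NoSignalling

variable {A B M : Type*} [Fintype A] [DecidableEq A] [Fintype B] [DecidableEq B]
  [DecidableEq M]

/-- The matrices `E k : A → B` are Choi-Kraus operators of a quantum channel
`ρ ↦ ∑ k, E k * ρ * (E k)ᴴ` from `L(A)` to `L(B)` (trace preservation; complete positivity is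
automatic). -/
def IsKrausFamily {κ : Type*} [Fintype κ] (E : κ → Matrix B A ℂ) : Prop :=
  ∑ k, (E k)ᴴ * E k = 1

/-- A non-commutative bipartite graph: the linear span of the Choi-Kraus operators of a quantum
channel. -/
def IsNCBipartiteGraph (K : Submodule ℂ (Matrix B A ℂ)) : Prop :=
  ∃ (r : ℕ) (E : Fin r → Matrix B A ℂ), IsKrausFamily E ∧
    K = Submodule.span ℂ (Set.range E)

/-- The linear map `E ↦ (𝟙 ⊗ E) ∑ a, |a⟩|a⟩`, i.e. `E ↦ ∑ a, |a⟩ ⊗ E|a⟩`, with values in the Hilbert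
space `A ⊗ B`. -/
def vecMap : Matrix B A ℂ →ₗ[ℂ] EuclideanSpace ℂ (A × B) where
  toFun E := WithLp.toLp 2 E.vec
  map_add' E F := by rw [Matrix.vec_add, WithLp.toLp_add]
  map_smul' c E := by rw [Matrix.vec_smul, WithLp.toLp_smul]; rfl

/-- The Choi-Jamiołkowski matrix `∑ i j, |i⟩⟨j| ⊗ N(|i⟩⟨j|)` of the channel `N` with Kraus
operators `E`. -/
def choiMatrix {κ : Type*} [Fintype κ] (E : κ → Matrix B A ℂ) : Matrix (A × B) (A × B) ℂ :=
  Matrix.of fun x y =>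
    (∑ k, E k * (Matrix.single x.1 y.1 1 : Matrix A A ℂ) * (E k)ᴴ : Matrix B B ℂ) x.2 y.2

/-- The Choi-Jamiołkowski projection `P_{AB}` of `K`: the orthogonal projection onto
`{(𝟙 ⊗ E) ∑ a, |a⟩|a⟩ : E ∈ K}`. By `range_choiMatrix` below this subspace is the support of the
Choi-Jamiołkowski matrix of every channel whose Choi-Kraus operators span `K`. -/
def choiProj (K : Submodule ℂ (Matrix B A ℂ)) : Matrix (A × B) (A × B) ℂ :=
  (Matrix.toEuclideanCLM (n := A × B) (𝕜 := ℂ)).symm (K.map vecMap).starProjection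

/-- The support (range) of the Choi-Jamiołkowski matrix depends only on the span of the Kraus
operators, and it is the subspace used in `choiProj`. -/
theorem range_choiMatrix {κ : Type*} [Fintype κ] [DecidableEq κ] (E : κ → Matrix B A ℂ) :
    (Matrix.toEuclideanLin (choiMatrix E)).range =
      (Submodule.span ℂ (Set.range E)).map vecMap := by
  let V : Matrix (A × B) κ ℂ := Matrix.of fun x k => (E k).vec x
  have h1 : choiMatrix E = V * Vᴴ := by
    ext x y
    simp [choiMatrix, V, Matrix.mul_apply, Matrix.sum_apply, Matrix.vec, Matrix.single_apply,
      ite_and]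
  have h2 : Matrix.toEuclideanLin (choiMatrix E) =
      Matrix.toEuclideanLin V ∘ₗ (Matrix.toEuclideanLin V).adjoint := by
    rw [h1, ← Matrix.toEuclideanLin_conjTranspose_eq_adjoint]
    ext x : 1
    simp [Matrix.toLpLin_apply]
  have h3 : ∀ x : EuclideanSpace ℂ κ,
      Matrix.toEuclideanLin V x = vecMap (∑ k, x k • E k) := by
    intro x
    ext y
    simp [Matrix.toLpLin_apply, Matrix.mulVec, dotProduct, V, vecMap, Matrix.vec,
      mul_comm]
  rw [h2, LinearMap.range_self_comp_adjoint]
  ext v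
  simp only [LinearMap.mem_range, Submodule.mem_map]
  constructor
  · rintro ⟨x, rfl⟩
    exact ⟨_, Submodule.sum_mem _ fun k _ => Submodule.smul_mem _ _
      (Submodule.subset_span ⟨k, rfl⟩), (h3 x).symm⟩
  · rintro ⟨F, hF, rfl⟩
    obtain ⟨c, rfl⟩ := (Submodule.mem_span_range_iff_exists_fun ℂ).1 hF
    exact ⟨WithLp.toLp 2 c, h3 _⟩

/-- The partial trace `tr_A`. -/
def trA (X : Matrix (A × B) (A × B) ℂ) : Matrix B B ℂ :=
  Matrix.of fun b b' => ∑ a, X (a, b) (a, b')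

/-- The operator norm `‖X‖_∞` (largest singular value). -/
def opNorm (X : Matrix B B ℂ) : ℝ := ‖Matrix.toEuclideanCLM (𝕜 := ℂ) X‖

/-- The tensor power `K^{⊗n}`: the span of all `E 0 ⊗ ⋯ ⊗ E (n - 1)` with `E i ∈ K`. -/
def tensorPow (K : Submodule ℂ (Matrix B A ℂ)) (n : ℕ) :
    Submodule ℂ (Matrix (Fin n → B) (Fin n → A) ℂ) :=
  Submodule.span ℂ {F | ∃ E : Fin n → Matrix B A ℂ, (∀ i, E i ∈ K) ∧
    F = Matrix.of fun b a => ∏ i, E i (b i) (a i)}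

/-- `Υ(K) = max tr S` subject to `0 ≤ U ≤ S ⊗ 𝟙`, `tr_A U = 𝟙`, `tr P (S ⊗ 𝟙 - U) = 0`. -/
def upsilon (K : Submodule ℂ (Matrix B A ℂ)) : ℝ :=
  sSup {t : ℝ | ∃ (S : Matrix A A ℂ) (U : Matrix (A × B) (A × B) ℂ),
    U.PosSemidef ∧ (S ⊗ₖ (1 : Matrix B B ℂ) - U).PosSemidef ∧
    trA U = 1 ∧
    (choiProj K * (S ⊗ₖ (1 : Matrix B B ℂ) - U)).trace = 0 ∧
    t = S.trace.re}

/-- `Υ̂(K) = max tr S` subject to `0 ≤ U ≤ S ⊗ 𝟙`, `tr_A U ≤ 𝟙`, `tr P (S ⊗ 𝟙 - U) = 0`. -/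
def upsilonHat (K : Submodule ℂ (Matrix B A ℂ)) : ℝ :=
  sSup {t : ℝ | ∃ (S : Matrix A A ℂ) (U : Matrix (A × B) (A × B) ℂ),
    U.PosSemidef ∧ (S ⊗ₖ (1 : Matrix B B ℂ) - U).PosSemidef ∧
    (1 - trA U).PosSemidef ∧
    (choiProj K * (S ⊗ₖ (1 : Matrix B B ℂ) - U)).trace = 0 ∧
    t = S.trace.re}

/-- The semidefinite (fractional) packing number
`A(K) = max tr S` subject to `0 ≤ S`, `tr_A P (S ⊗ 𝟙) ≤ 𝟙`. -/
def packing (K : Submodule ℂ (Matrix B A ℂ)) : ℝ :=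
  sSup {t : ℝ | ∃ S : Matrix A A ℂ, S.PosSemidef ∧
    (1 - trA (choiProj K * (S ⊗ₖ (1 : Matrix B B ℂ)))).PosSemidef ∧
    t = S.trace.re}

/-- The no-signalling assisted zero-error capacity
`C_{0,NS}(K) = sup_{n ≥ 1} (1/n) log₂ Υ(K^{⊗n})`. -/
def capacity (K : Submodule ℂ (Matrix B A ℂ)) : ℝ :=
  sSup {t : ℝ | ∃ n : ℕ, 1 ≤ n ∧ t = (1 / (n : ℝ)) * Real.logb 2 (upsilon (tensorPow K n))}

/-- The cq-graph of a cq-channel `|m⟩⟨m| ↦ ρ m` whose output states `ρ m` have supports `V m`: the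
span of the operators `|v⟩⟨m|` with `v ∈ V m`. -/
def cqGraph (V : M → Submodule ℂ (B → ℂ)) : Submodule ℂ (Matrix B M ℂ) :=
  Submodule.span ℂ {F | ∃ m, ∃ v ∈ V m, F = Matrix.vecMulVec v (Pi.single m 1)}

/-- The generalized Pauli matrices `X^j Z^k` on `ℂ^d`, where `X|a⟩ = |a + 1 mod d⟩` and
`Z|a⟩ = exp(2πi a / d)|a⟩`. -/
def pauli (d : ℕ) [NeZero d] (m : Fin d × Fin d) : Matrix (Fin d) (Fin d) ℂ :=
  Matrix.of fun a' a => if a' = a + m.1 then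
    Complex.exp (2 * Real.pi * Complex.I * ((m.2 : ℕ) : ℂ) * ((a : ℕ) : ℂ) / (d : ℂ)) else 0

/-- The cq-graph of the cq-channel obtained by super-dense coding. It has `d²` inputs `m` and
outputs `(U_m ⊗ 𝟙) J (U_m ⊗ 𝟙)ᴴ` on `A ⊗ B` (up to normalization), where `J` is the
Choi-Jamiołkowski matrix and `U_m` are the generalized Pauli matrices on `A`; the support of
output `m` is `(U_m ⊗ 𝟙)` applied to the support of `J`. -/
def superdenseGraph {d : ℕ} [NeZero d] (K : Submodule ℂ (Matrix B (Fin d) ℂ)) :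
    Submodule ℂ (Matrix (Fin d × B) (Fin d × Fin d) ℂ) :=
  cqGraph fun m => Submodule.span ℂ
    {v | ∃ E ∈ K, v = (pauli d m ⊗ₖ (1 : Matrix B B ℂ)) *ᵥ E.vec}

end NoSignalling

end

/-!
The pivot of the equivalences is whether `tr_A (𝟙 - P)` is invertible.

A positive operator `ω` on `B` for which `𝟙 ⊗ ω` commutes with `P` and `tr_B (𝟙 ⊗ ω) P ≥ 𝟙` bounds
both `Υ̂(K)` and `A(K)` by `tr ω`, and its tensor powers do the same for the tensor powers of `K`.
If `tr_A (𝟙 - P)` kills a unit vector `v`, then `ω = |v⟩⟨v|` is such an operator and has trace one,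
so `Υ̂(K) ≤ 1`, `A(K) ≤ 1` and the capacity vanishes.

If `tr_A (𝟙 - P)` is invertible, the feasible point `S = 𝟙 / ‖P_B‖`, `U = P / ‖P_B‖` already gives
values greater than one. For the capacity one needs `tr_A U = 𝟙` exactly. The deficit of `U^{⊗n}` is
made up by two further uses of the channel: the complement of `P ⊗ P` supports an operator with the
same partial trace as `P ⊗ P`, and the zero-error constraint does not see that complement. The cost
is a constant factor in `tr S`, which disappears in the rate.

For super-dense coding, `tr_A` is blind to the unitaries `U_m`, which gives the upper bound, and the
twirl `∑ m, U_m X U_mᴴ = d (tr X) 𝟙` shows that the uniform input distribution attains it.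
-/

noncomputable section

namespace NoSignalling

open Matrix
open scoped MatrixOrder

section Loewner

variable {𝕜 m n : Type*} [RCLike 𝕜]

section Trace

variable [Fintype n]

theorem trace_mul_nonneg {X Y : Matrix n n 𝕜} (hX : 0 ≤ X) (hY : 0 ≤ Y) : 0 ≤ (X * Y).trace := by
  classical
  obtain ⟨Z, rfl⟩ := CStarAlgebra.nonneg_iff_eq_star_mul_self.1 hX
  rw [Matrix.mul_assoc, trace_mul_comm]
  exact (hY.posSemidef.mul_mul_conjTranspose_same Z).trace_nonneg

theorem trace_mul_le_trace_mul_left {X Y Z : Matrix n n 𝕜} (hX : 0 ≤ X) (hYZ : Y ≤ Z) :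
    (X * Y).trace ≤ (X * Z).trace := by
  have h := trace_mul_nonneg hX (sub_nonneg.2 hYZ)
  rwa [Matrix.mul_sub, trace_sub, sub_nonneg] at h

theorem trace_mul_le_trace_mul_right {X Y Z : Matrix n n 𝕜} (hXY : X ≤ Y) (hZ : 0 ≤ Z) :
    (X * Z).trace ≤ (Y * Z).trace := by
  rw [trace_mul_comm X, trace_mul_comm Y]
  exact trace_mul_le_trace_mul_left hZ hXY

theorem mul_eq_zero_of_trace_mul_eq_zero {X Y : Matrix n n 𝕜} (hX : 0 ≤ X) (hY : 0 ≤ Y)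
    (h : (X * Y).trace = 0) : X * Y = 0 := by
  classical
  obtain ⟨S, rfl⟩ := CStarAlgebra.nonneg_iff_eq_star_mul_self.1 hX
  obtain ⟨T, rfl⟩ := CStarAlgebra.nonneg_iff_eq_star_mul_self.1 hY
  have hST : S * star T = 0 := by
    rw [← trace_mul_conjTranspose_self_eq_zero_iff, ← h, ← star_eq_conjTranspose, star_mul,
      star_star, Matrix.mul_assoc (star S), trace_mul_comm (star S)]
    simp only [Matrix.mul_assoc]
  calc star S * S * (star T * T) = star S * (S * star T) * T := by simp only [Matrix.mul_assoc]
    _ = 0 := by rw [hST, Matrix.mul_zero, Matrix.zero_mul]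

theorem ofReal_re_trace {X : Matrix n n ℂ} (hX : X.IsHermitian) :
    ((X.trace.re : ℝ) : ℂ) = X.trace := by
  apply Complex.conj_eq_iff_re.1
  rw [starRingEnd_apply, ← trace_conjTranspose, hX.eq]

end Trace

variable [Finite m] [Finite n]

theorem kronecker_nonneg {X : Matrix m m 𝕜} {Y : Matrix n n 𝕜} (hX : 0 ≤ X) (hY : 0 ≤ Y) :
    0 ≤ X ⊗ₖ Y :=
  (hX.posSemidef.kronecker hY.posSemidef).nonneg

theorem kronecker_le_kronecker_left {X : Matrix m m 𝕜} {Y Z : Matrix n n 𝕜} (hX : 0 ≤ X)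
    (hYZ : Y ≤ Z) : X ⊗ₖ Y ≤ X ⊗ₖ Z := by
  have h : X ⊗ₖ Z - X ⊗ₖ Y = X ⊗ₖ (Z - Y) := by ext; simp [mul_sub]
  rw [← sub_nonneg, h]
  exact kronecker_nonneg hX (sub_nonneg.2 hYZ)

end Loewner

theorem le_trace_smul_one {n : Type*} [Fintype n] [DecidableEq n] {X : Matrix n n ℂ}
    (hX : 0 ≤ X) : X ≤ X.trace.re • 1 := by
  have hherm := hX.posSemidef.isHermitian
  rw [← Algebra.algebraMap_eq_smul_one, le_algebraMap_iff_spectrum_le,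
    hherm.spectrum_real_eq_range_eigenvalues]
  rintro _ ⟨i, rfl⟩
  rw [hherm.trace_eq_sum_eigenvalues, Complex.re_sum]
  exact Finset.single_le_sum (f := hherm.eigenvalues)
    (fun j _ => hX.posSemidef.eigenvalues_nonneg j) (Finset.mem_univ i)

section OpNorm

open scoped Matrix.Norms.L2Operator

theorem exists_pos_smul_one_le {n : Type*} [Finite n] [DecidableEq n] {X : Matrix n n ℂ}
    (hX : X.PosDef) : ∃ c : ℝ, 0 < c ∧ c • 1 ≤ X := by
  cases nonempty_fintype n
  cases isEmpty_or_nonempty n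
  · exact ⟨1, one_pos, (Subsingleton.elim _ _).le⟩
  · obtain ⟨c, hc, h⟩ := (CFC.exists_pos_algebraMap_le_iff hX.isHermitian).2
      fun x hx => (isStrictlyPositive_iff_posDef.2 hX).spectrum_pos hx
    exact ⟨c, hc, by rwa [← Algebra.algebraMap_eq_smul_one]⟩

variable {n : Type*} [Fintype n] [DecidableEq n] {X : Matrix n n ℂ}

theorem opNorm_nonneg (X : Matrix n n ℂ) : 0 ≤ opNorm X := norm_nonneg _

theorem opNorm_eq_zero : opNorm X = 0 ↔ X = 0 := by
  rw [opNorm, norm_eq_zero, EmbeddingLike.map_eq_zero_iff]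

theorem opNorm_smul (c : ℝ) (X : Matrix n n ℂ) : opNorm (c • X) = |c| * opNorm X := by
  rw [opNorm, ← Complex.coe_smul, map_smul, norm_smul, Complex.norm_real, Real.norm_eq_abs, opNorm]

theorem opNorm_le_iff (hX : 0 ≤ X) {r : ℝ} (hr : 0 ≤ r) : opNorm X ≤ r ↔ X ≤ r • 1 := by
  rw [← Algebra.algebraMap_eq_smul_one]
  exact CStarAlgebra.norm_le_iff_le_algebraMap X hr hX

theorem le_opNorm_smul_one (hX : X.IsHermitian) : X ≤ opNorm X • 1 := by
  rw [← Algebra.algebraMap_eq_smul_one]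
  exact IsSelfAdjoint.le_algebraMap_norm_self (a := X) hX

theorem neg_opNorm_smul_one_le (hX : X.IsHermitian) : -(opNorm X • 1) ≤ X := by
  rw [← Algebra.algebraMap_eq_smul_one]
  exact IsSelfAdjoint.neg_algebraMap_norm_le_self (a := X) hX

end OpNorm

section PartialTrace

variable {A B : Type*}

section Trace

variable [Fintype A]

theorem trA_add (X Y : Matrix (A × B) (A × B) ℂ) : trA (X + Y) = trA X + trA Y := by
  ext; simp [trA, Finset.sum_add_distrib]

theorem trA_sub (X Y : Matrix (A × B) (A × B) ℂ) : trA (X - Y) = trA X - trA Y := by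
  ext; simp [trA]

theorem trA_smul (c : ℝ) (X : Matrix (A × B) (A × B) ℂ) : trA (c • X) = c • trA X := by
  ext; simp [trA, Finset.mul_sum]

theorem trA_sum_smul {ι : Type*} (s : Finset ι) (c : ι → ℂ) (X : ι → Matrix (A × B) (A × B) ℂ) :
    trA (∑ i ∈ s, c i • X i) = ∑ i ∈ s, c i • trA (X i) := by
  ext
  simp only [trA, of_apply, Matrix.sum_apply, Matrix.smul_apply, Finset.smul_sum]
  exact Finset.sum_comm

theorem trA_conjTranspose (X : Matrix (A × B) (A × B) ℂ) : trA Xᴴ = (trA X)ᴴ := by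
  ext; simp [trA]

theorem trA_kronecker (S : Matrix A A ℂ) (T : Matrix B B ℂ) : trA (S ⊗ₖ T) = S.trace • T := by
  ext; simp [trA, trace, Finset.sum_mul]

theorem trA_one [DecidableEq A] [DecidableEq B] :
    trA (1 : Matrix (A × B) (A × B) ℂ) = (Fintype.card A : ℂ) • 1 := by
  rw [← one_kronecker_one, trA_kronecker, trace_one]

theorem trA_submatrix {A' B' : Type*} [Fintype A'] (X : Matrix (A × B) (A × B) ℂ) (e : A' ≃ A)
    (f : B' ≃ B) :
    trA (X.submatrix (e.prodCongr f) (e.prodCongr f)) = (trA X).submatrix f f := by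
  ext b b'
  exact Equiv.sum_comp e fun a => X (a, f b) (a, f b')

theorem trace_trA [Fintype B] (X : Matrix (A × B) (A × B) ℂ) : (trA X).trace = X.trace := by
  simp [trA, trace, Fintype.sum_prod_type_right]

theorem trA_nonneg {X : Matrix (A × B) (A × B) ℂ} (hX : 0 ≤ X) : 0 ≤ trA X := by
  have h : trA X = ∑ a, X.submatrix (Prod.mk a) (Prod.mk a) := by
    ext; simp [trA, Matrix.sum_apply]
  rw [h]
  exact Finset.sum_nonneg fun a _ => (hX.posSemidef.submatrix _).nonneg

theorem trA_mono {X Y : Matrix (A × B) (A × B) ℂ} (h : X ≤ Y) : trA X ≤ trA Y := by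
  rw [← sub_nonneg, ← trA_sub]
  exact trA_nonneg (sub_nonneg.2 h)

end Trace

section Module

variable [Fintype A] [Fintype B]

theorem trA_mul_one_kronecker [DecidableEq A] (X : Matrix (A × B) (A × B) ℂ)
    (T : Matrix B B ℂ) : trA (X * ((1 : Matrix A A ℂ) ⊗ₖ T)) = trA X * T := by
  ext b b'
  simp only [trA, of_apply, mul_apply, Fintype.sum_prod_type, kronecker_apply, one_apply,
    Finset.sum_mul, ite_mul, one_mul, zero_mul, mul_ite, mul_zero]
  rw [Finset.sum_comm (s := (Finset.univ : Finset B))]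
  refine Finset.sum_congr rfl fun a _ => ?_
  rw [Finset.sum_comm]
  simp

theorem trA_one_kronecker_mul [DecidableEq A] (X : Matrix (A × B) (A × B) ℂ)
    (T : Matrix B B ℂ) : trA (((1 : Matrix A A ℂ) ⊗ₖ T) * X) = T * trA X := by
  have h := congrArg conjTranspose (trA_mul_one_kronecker Xᴴ Tᴴ)
  simpa [← trA_conjTranspose, conjTranspose_kronecker] using h

theorem trA_mul_kronecker_one_comm {A' : Type*} [Fintype A'] [DecidableEq B]
    (X : Matrix (A × B) (A' × B) ℂ) (S : Matrix A' A ℂ) :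
    trA (X * (S ⊗ₖ (1 : Matrix B B ℂ))) = trA ((S ⊗ₖ (1 : Matrix B B ℂ)) * X) := by
  ext b b'
  simp only [trA, of_apply, mul_apply, Fintype.sum_prod_type, kronecker_apply, one_apply,
    ite_mul, zero_mul, mul_ite, mul_zero, mul_one, Finset.sum_ite_eq, Finset.sum_ite_eq',
    Finset.mem_univ, if_true]
  rw [Finset.sum_comm]
  simp only [mul_comm]

end Module

/-- The partial trace `tr_B`. -/
def trB [Fintype B] (X : Matrix (A × B) (A × B) ℂ) : Matrix A A ℂ :=
  Matrix.of fun a a' => ∑ b, X (a, b) (a', b)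

theorem trB_zero [Fintype B] : trB (0 : Matrix (A × B) (A × B) ℂ) = 0 := by
  ext; simp [trB]

theorem trB_kronecker [Fintype B] (S : Matrix A A ℂ) (T : Matrix B B ℂ) :
    trB (S ⊗ₖ T) = T.trace • S := by
  ext; simp [trB, trace, Finset.mul_sum, mul_comm]

theorem trB_mono [Fintype B] {X Y : Matrix (A × B) (A × B) ℂ} (h : X ≤ Y) : trB X ≤ trB Y := by
  have hsum : trB Y - trB X = ∑ b, (Y - X).submatrix (·, b) (·, b) := by
    ext; simp [trB, Matrix.sum_apply]
  rw [← sub_nonneg, hsum]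
  exact Finset.sum_nonneg fun b _ => ((sub_nonneg.2 h).posSemidef.submatrix _).nonneg

theorem trace_mul_kronecker_one [Fintype A] [Fintype B] [DecidableEq B]
    (X : Matrix (A × B) (A × B) ℂ) (S : Matrix A A ℂ) :
    (X * (S ⊗ₖ (1 : Matrix B B ℂ))).trace = (trB X * S).trace := by
  simp only [trace, diag_apply, mul_apply, Fintype.sum_prod_type, kronecker_apply, one_apply,
    mul_ite, mul_one, mul_zero, Finset.sum_ite_eq', Finset.mem_univ, if_true, trB, of_apply,
    Finset.sum_mul]
  exact Finset.sum_congr rfl fun a _ => Finset.sum_comm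

end PartialTrace

/-- The tensor product of two operators on bipartite spaces, regrouped as an operator on the
bipartite space `(A ⊗ A') ⊗ (B ⊗ B')`. -/
def biKronecker {R A B A' B' : Type*} [Mul R] (X : Matrix (A × B) (A × B) R)
    (Y : Matrix (A' × B') (A' × B') R) :
    Matrix ((A × A') × (B × B')) ((A × A') × (B × B')) R :=
  (X ⊗ₖ Y).submatrix (Equiv.prodProdProdComm A A' B B') (Equiv.prodProdProdComm A A' B B')

local infixl:100 " ⊠ₖ " => biKronecker

section BiKronecker

variable {R A B A' B' : Type*}

section Algebra

theorem zero_biKronecker [MulZeroClass R] (Y : Matrix (A' × B') (A' × B') R) :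
    (0 : Matrix (A × B) (A × B) R) ⊠ₖ Y = 0 := by
  ext; simp [biKronecker]

theorem biKronecker_zero [MulZeroClass R] (X : Matrix (A × B) (A × B) R) :
    X ⊠ₖ (0 : Matrix (A' × B') (A' × B') R) = 0 := by
  ext; simp [biKronecker]

theorem biKronecker_add [NonUnitalNonAssocSemiring R] (X : Matrix (A × B) (A × B) R)
    (Y Z : Matrix (A' × B') (A' × B') R) : X ⊠ₖ (Y + Z) = X ⊠ₖ Y + X ⊠ₖ Z := by
  ext; simp [biKronecker, mul_add]

theorem biKronecker_sub [NonUnitalNonAssocRing R] (X : Matrix (A × B) (A × B) R)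
    (Y Z : Matrix (A' × B') (A' × B') R) : X ⊠ₖ (Y - Z) = X ⊠ₖ Y - X ⊠ₖ Z := by
  ext; simp [biKronecker, mul_sub]

theorem sub_biKronecker [NonUnitalNonAssocRing R] (X Y : Matrix (A × B) (A × B) R)
    (Z : Matrix (A' × B') (A' × B') R) : (X - Y) ⊠ₖ Z = X ⊠ₖ Z - Y ⊠ₖ Z := by
  ext; simp [biKronecker, sub_mul]

theorem biKronecker_smul {α : Type*} [SMul α R] [Mul R] [SMulCommClass α R R] (c : α)
    (X : Matrix (A × B) (A × B) R) (Y : Matrix (A' × B') (A' × B') R) :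
    X ⊠ₖ (c • Y) = c • (X ⊠ₖ Y) := by
  ext; simp [biKronecker, mul_smul_comm]

theorem biKronecker_conjTranspose [CommSemiring R] [StarRing R] (X : Matrix (A × B) (A × B) R)
    (Y : Matrix (A' × B') (A' × B') R) : (X ⊠ₖ Y)ᴴ = Xᴴ ⊠ₖ Yᴴ := by
  ext; simp [biKronecker]

theorem biKronecker_mul [CommSemiring R] [Fintype A] [Fintype B] [Fintype A'] [Fintype B']
    (X₁ X₂ : Matrix (A × B) (A × B) R) (Y₁ Y₂ : Matrix (A' × B') (A' × B') R) :
    (X₁ * X₂) ⊠ₖ (Y₁ * Y₂) = (X₁ ⊠ₖ Y₁) * (X₂ ⊠ₖ Y₂) := by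
  rw [biKronecker, mul_kronecker_mul, biKronecker, biKronecker, submatrix_mul_equiv]

theorem kronecker_biKronecker_kronecker [CommSemiring R] (S : Matrix A A R) (T : Matrix B B R)
    (S' : Matrix A' A' R) (T' : Matrix B' B' R) :
    (S ⊗ₖ T) ⊠ₖ (S' ⊗ₖ T') = (S ⊗ₖ S') ⊗ₖ (T ⊗ₖ T') := by
  ext; simp [biKronecker, mul_mul_mul_comm]

theorem trA_biKronecker [Fintype A] [Fintype A'] (X : Matrix (A × B) (A × B) ℂ)
    (Y : Matrix (A' × B') (A' × B') ℂ) : trA (X ⊠ₖ Y) = trA X ⊗ₖ trA Y := by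
  ext
  simp [trA, biKronecker, Fintype.sum_prod_type, Finset.sum_mul_sum]

theorem trace_biKronecker [CommSemiring R] [Fintype A] [Fintype B] [Fintype A'] [Fintype B']
    (X : Matrix (A × B) (A × B) R) (Y : Matrix (A' × B') (A' × B') R) :
    (X ⊠ₖ Y).trace = X.trace * Y.trace := by
  rw [← trace_kronecker]
  exact Equiv.sum_comp (Equiv.prodProdProdComm A A' B B') (X ⊗ₖ Y).diag

end Algebra

section Order

variable {𝕜 : Type*} [RCLike 𝕜] [Finite A] [Finite B] [Finite A'] [Finite B']

theorem biKronecker_nonneg {X : Matrix (A × B) (A × B) 𝕜} {Y : Matrix (A' × B') (A' × B') 𝕜}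
    (hX : 0 ≤ X) (hY : 0 ≤ Y) : 0 ≤ X ⊠ₖ Y :=
  ((kronecker_nonneg hX hY).posSemidef.submatrix _).nonneg

theorem biKronecker_le_biKronecker_left {X : Matrix (A × B) (A × B) 𝕜}
    {Y Z : Matrix (A' × B') (A' × B') 𝕜} (hX : 0 ≤ X) (hYZ : Y ≤ Z) : X ⊠ₖ Y ≤ X ⊠ₖ Z := by
  rw [← sub_nonneg, ← biKronecker_sub]
  exact biKronecker_nonneg hX (sub_nonneg.2 hYZ)

theorem biKronecker_le_biKronecker_right {X Y : Matrix (A × B) (A × B) 𝕜}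
    {Z : Matrix (A' × B') (A' × B') 𝕜} (hXY : X ≤ Y) (hZ : 0 ≤ Z) : X ⊠ₖ Z ≤ Y ⊠ₖ Z := by
  rw [← sub_nonneg, ← sub_biKronecker]
  exact biKronecker_nonneg (sub_nonneg.2 hXY) hZ

end Order

end BiKronecker

section PiKronecker

variable {R ι l m n : Type*} [Fintype ι]

/-- The tensor product `⨂ i, f i` of a family of matrices of the same shape. -/
def piKronecker [CommMonoid R] (f : ι → Matrix m n R) : Matrix (ι → m) (ι → n) R :=
  Matrix.of fun x y => ∏ i, f i (x i) (y i)

section Algebra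

theorem piKronecker_mul [CommSemiring R] [DecidableEq ι] [Fintype m] (f : ι → Matrix l m R)
    (g : ι → Matrix m n R) :
    piKronecker (fun i => f i * g i) = piKronecker f * piKronecker g := by
  ext x y
  simp [piKronecker, mul_apply, Finset.prod_univ_sum, Finset.prod_mul_distrib]

theorem piKronecker_conjTranspose [CommSemiring R] [StarRing R] (f : ι → Matrix m n R) :
    (piKronecker f)ᴴ = piKronecker fun i => (f i)ᴴ := by
  ext x y
  simp [piKronecker]

theorem piKronecker_one [CommSemiring R] [DecidableEq n] :
    piKronecker (fun _ : ι => (1 : Matrix n n R)) = 1 := by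
  ext x y
  simp [piKronecker, one_apply, Finset.prod_ite_zero, funext_iff]

theorem trace_piKronecker [CommSemiring R] [DecidableEq ι] [Fintype n] (f : ι → Matrix n n R) :
    (piKronecker f).trace = ∏ i, (f i).trace := by
  simp [piKronecker, trace, Finset.prod_univ_sum]

theorem piKronecker_add [CommSemiring R] [DecidableEq ι] (f g : ι → Matrix m n R) :
    piKronecker (f + g) = ∑ t : Finset ι, piKronecker (t.piecewise f g) := by
  ext x y
  have h : ∀ (t : Finset ι) i, t.piecewise f g i (x i) (y i) =
      t.piecewise (fun j => f j (x j) (y j)) (fun j => g j (x j) (y j)) i :=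
    fun t i => by by_cases hi : i ∈ t <;> simp [hi]
  simp [piKronecker, Matrix.sum_apply, h, Finset.prod_add, Finset.prod_piecewise]

end Algebra

section Order

variable {𝕜 : Type*} [RCLike 𝕜] [Finite n] {f g : ι → Matrix n n 𝕜}

theorem piKronecker_nonneg (hf : ∀ i, 0 ≤ f i) : 0 ≤ piKronecker f := by
  classical
  cases nonempty_fintype n
  choose Y hY using fun i => CStarAlgebra.nonneg_iff_eq_star_mul_self.1 (hf i)
  have h : piKronecker f = star (piKronecker Y) * piKronecker Y := by
    rw [star_eq_conjTranspose, piKronecker_conjTranspose, ← piKronecker_mul]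
    exact congrArg piKronecker (funext hY)
  rw [h]
  exact star_mul_self_nonneg _

theorem piKronecker_mono (hf : ∀ i, 0 ≤ f i) (hfg : ∀ i, f i ≤ g i) :
    piKronecker f ≤ piKronecker g := by
  classical
  have hnonneg : ∀ t : Finset ι, 0 ≤ piKronecker (t.piecewise f (g - f)) := fun t =>
    piKronecker_nonneg fun i => by
      by_cases hi : i ∈ t
      · simpa [hi] using hf i
      · simpa [hi] using hfg i
  calc piKronecker f = piKronecker (Finset.univ.piecewise f (g - f)) := by simp
    _ ≤ ∑ t : Finset ι, piKronecker (t.piecewise f (g - f)) :=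
      Finset.single_le_sum (fun t _ => hnonneg t) (Finset.mem_univ _)
    _ = piKronecker g := by rw [← piKronecker_add, add_sub_cancel]

end Order

end PiKronecker

section BiPow

variable {R ι A B : Type*} [Fintype ι]

/-- The tensor power of a bipartite operator, regrouped as a bipartite operator. -/
def biPow (ι : Type*) [Fintype ι] [CommMonoid R] (X : Matrix (A × B) (A × B) R) :
    Matrix ((ι → A) × (ι → B)) ((ι → A) × (ι → B)) R :=
  (piKronecker fun _ : ι => X).submatrix
    (Equiv.arrowProdEquivProdArrow ι (fun _ => A) (fun _ => B)).symm
    (Equiv.arrowProdEquivProdArrow ι (fun _ => A) (fun _ => B)).symm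

section Algebra

theorem biPow_apply [CommMonoid R] (X : Matrix (A × B) (A × B) R) (x y : (ι → A) × (ι → B)) :
    biPow ι X x y = ∏ i, X (x.1 i, x.2 i) (y.1 i, y.2 i) := rfl

variable [CommSemiring R]

theorem biPow_mul [DecidableEq ι] [Fintype A] [Fintype B] (X Y : Matrix (A × B) (A × B) R) :
    biPow ι (X * Y) = biPow ι X * biPow ι Y := by
  rw [biPow, piKronecker_mul, biPow, biPow, submatrix_mul_equiv]

theorem biPow_conjTranspose [StarRing R] (X : Matrix (A × B) (A × B) R) :
    (biPow ι X)ᴴ = biPow ι Xᴴ := by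
  rw [biPow, conjTranspose_submatrix, piKronecker_conjTranspose, biPow]

theorem trace_biPow [DecidableEq ι] [Fintype A] [Fintype B] (X : Matrix (A × B) (A × B) R) :
    (biPow ι X).trace = X.trace ^ Fintype.card ι := by
  have h : (biPow ι X).trace = (piKronecker fun _ : ι => X).trace :=
    Equiv.sum_comp (Equiv.arrowProdEquivProdArrow ι (fun _ => A) (fun _ => B)).symm
      fun i => piKronecker (fun _ : ι => X) i i
  rw [h, trace_piKronecker, Finset.prod_const, Finset.card_univ]

theorem biPow_kronecker (S : Matrix A A R) (T : Matrix B B R) :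
    biPow ι (S ⊗ₖ T) = (piKronecker fun _ => S) ⊗ₖ piKronecker fun _ => T := by
  ext
  simp [biPow_apply, piKronecker, Finset.prod_mul_distrib]

theorem biPow_kronecker_one [DecidableEq B] (S : Matrix A A R) :
    biPow ι (S ⊗ₖ (1 : Matrix B B R)) = (piKronecker fun _ => S) ⊗ₖ 1 := by
  rw [biPow_kronecker, piKronecker_one]

theorem one_kronecker_biPow [DecidableEq A] (T : Matrix B B R) :
    biPow ι ((1 : Matrix A A R) ⊗ₖ T) = 1 ⊗ₖ piKronecker fun _ => T := by
  rw [biPow_kronecker, piKronecker_one]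

theorem trA_biPow [DecidableEq ι] [Fintype A] (X : Matrix (A × B) (A × B) ℂ) :
    trA (biPow ι X) = piKronecker fun _ => trA X := by
  ext
  simp [trA, biPow_apply, piKronecker, Finset.prod_univ_sum]

theorem trB_biPow [DecidableEq ι] [Fintype B] (X : Matrix (A × B) (A × B) ℂ) :
    trB (biPow ι X) = piKronecker fun _ => trB X := by
  ext
  simp [trB, biPow_apply, piKronecker, Finset.prod_univ_sum]

end Algebra

section Order

variable {𝕜 : Type*} [RCLike 𝕜] [Finite A] [Finite B]
  {X Y : Matrix (A × B) (A × B) 𝕜}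

theorem biPow_nonneg (hX : 0 ≤ X) : 0 ≤ biPow ι X :=
  ((piKronecker_nonneg fun _ => hX).posSemidef.submatrix _).nonneg

theorem biPow_mono (hX : 0 ≤ X) (hXY : X ≤ Y) : biPow ι X ≤ biPow ι Y :=
  le_iff.2 ((le_iff.1 (piKronecker_mono (fun _ => hX) fun _ => hXY)).submatrix _)

end Order

end BiPow

section Vec

variable {A B : Type*} [Fintype A] [Fintype B]

theorem mul_eq_self_of_forall_col_eq_vec {K : Submodule ℂ (Matrix B A ℂ)}
    {P X : Matrix (A × B) (A × B) ℂ}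
    (hP : ∀ F ∈ K, P *ᵥ F.vec = F.vec) (hX : ∀ y, ∃ F ∈ K, F.vec = X.col y) :
    P * X = X := by
  refine Matrix.ext_col fun y => ?_
  obtain ⟨F, hF, h⟩ := hX y
  have hy : P *ᵥ X.col y = X.col y := by rw [← h, hP F hF]
  exact hy

theorem biPow_mulVec_vec_piKronecker {ι : Type*} [Fintype ι] [DecidableEq ι]
    (X : Matrix (A × B) (A × B) ℂ) {E : ι → Matrix B A ℂ}
    (hE : ∀ i, X *ᵥ (E i).vec = (E i).vec) :
    biPow ι X *ᵥ (piKronecker E).vec = (piKronecker E).vec := by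
  ext x
  have h : ∀ i, ∑ z, X (x.1 i, x.2 i) z * (E i).vec z = E i (x.2 i) (x.1 i) :=
    fun i => congrFun (hE i) (x.1 i, x.2 i)
  simp only [piKronecker, vec, of_apply, ← h, Finset.prod_univ_sum, mulVec, dotProduct,
    biPow_apply, Fintype.piFinset_univ, ← Finset.prod_mul_distrib]
  exact Equiv.sum_comp (Equiv.arrowProdEquivProdArrow ι (fun _ => A) (fun _ => B)).symm
    fun z => ∏ i, X (x.1 i, x.2 i) (z i) * E i (z i).2 (z i).1

end Vec

section ChoiProj

variable {A B : Type*} [Fintype A] [DecidableEq A] [Fintype B] [DecidableEq B]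
  {K : Submodule ℂ (Matrix B A ℂ)}

theorem isStarProjection_choiProj (K : Submodule ℂ (Matrix B A ℂ)) :
    IsStarProjection (choiProj K) :=
  isStarProjection_starProjection.map
    (Matrix.toEuclideanCLM (n := A × B) (𝕜 := ℂ)).symm.toStarAlgHom

theorem toLp_choiProj_mulVec (K : Submodule ℂ (Matrix B A ℂ)) (v : A × B → ℂ) :
    WithLp.toLp 2 (choiProj K *ᵥ v) = (K.map vecMap).starProjection (WithLp.toLp 2 v) := by
  rw [← Matrix.toEuclideanCLM_toLp, choiProj, StarAlgEquiv.apply_symm_apply]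

theorem choiProj_mulVec_vec {F : Matrix B A ℂ} (hF : F ∈ K) : choiProj K *ᵥ F.vec = F.vec := by
  have hmem : WithLp.toLp 2 F.vec ∈ K.map vecMap := ⟨F, hF, rfl⟩
  apply WithLp.toLp_injective 2
  rw [toLp_choiProj_mulVec, Submodule.starProjection_eq_self_iff.2 hmem]

theorem exists_mem_vec_eq_choiProj_mulVec (K : Submodule ℂ (Matrix B A ℂ)) (v : A × B → ℂ) :
    ∃ F ∈ K, F.vec = choiProj K *ᵥ v := by
  obtain ⟨F, hF, h⟩ := Submodule.starProjection_apply_mem (K.map vecMap) (WithLp.toLp 2 v)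
  exact ⟨F, hF, WithLp.toLp_injective 2 (h.trans (toLp_choiProj_mulVec K v).symm)⟩

theorem exists_mem_vec_eq_choiProj_col (K : Submodule ℂ (Matrix B A ℂ)) (y : A × B) :
    ∃ F ∈ K, F.vec = (choiProj K).col y := by
  obtain ⟨F, hF, h⟩ := exists_mem_vec_eq_choiProj_mulVec K (Pi.single y 1)
  exact ⟨F, hF, by rw [h, mulVec_single_one]⟩

theorem choiProj_eq {P : Matrix (A × B) (A × B) ℂ} (hP : P.IsHermitian)
    (hfix : ∀ F ∈ K, P *ᵥ F.vec = F.vec) (hcol : ∀ y, ∃ F ∈ K, F.vec = P.col y) :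
    choiProj K = P := by
  have hKP : choiProj K * P = P :=
    mul_eq_self_of_forall_col_eq_vec (fun _ => choiProj_mulVec_vec) hcol
  have hPK : P * choiProj K = choiProj K :=
    mul_eq_self_of_forall_col_eq_vec hfix (exists_mem_vec_eq_choiProj_col K)
  have hstar := congrArg star hKP
  rwa [star_mul, (isStarProjection_choiProj K).isSelfAdjoint.star_eq,
    star_eq_conjTranspose, hP.eq, hPK] at hstar

theorem choiProj_tensorPow (K : Submodule ℂ (Matrix B A ℂ)) (n : ℕ) :
    choiProj (tensorPow K n) = biPow (Fin n) (choiProj K) := by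
  have hherm : (biPow (Fin n) (choiProj K)).IsHermitian := by
    rw [IsHermitian, biPow_conjTranspose, ← star_eq_conjTranspose,
      (isStarProjection_choiProj K).isSelfAdjoint.star_eq]
  refine choiProj_eq hherm (fun F hF => ?_) fun y => ?_
  · induction hF using Submodule.span_induction with
    | mem F hF =>
      obtain ⟨E, hE, rfl⟩ := hF
      exact biPow_mulVec_vec_piKronecker _ fun i => choiProj_mulVec_vec (hE i)
    | zero => rw [vec_zero, mulVec_zero]
    | add F G _ _ hF hG => rw [vec_add, mulVec_add, hF, hG]
    | smul c F _ hF => rw [vec_smul, mulVec_smul, hF]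
  · choose E hE h using fun i => exists_mem_vec_eq_choiProj_col K (y.1 i, y.2 i)
    refine ⟨_, Submodule.subset_span ⟨E, hE, rfl⟩, ?_⟩
    ext x
    simp only [vec, of_apply, col_apply, biPow_apply]
    exact Finset.prod_congr rfl fun i _ => congrFun (h i) (x.1 i, x.2 i)

end ChoiProj

section ChoiMatrix

variable {A B κ : Type*} [Fintype A] [DecidableEq A] [Fintype κ]

theorem choiMatrix_apply (E : κ → Matrix B A ℂ) (x y : A × B) :
    choiMatrix E x y = ∑ k, E k x.2 x.1 * star (E k y.2 y.1) := by
  simp [choiMatrix, mul_apply, Matrix.sum_apply, single_apply, ite_and]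

theorem choiMatrix_nonneg [Finite B] (E : κ → Matrix B A ℂ) : 0 ≤ choiMatrix E := by
  have h : choiMatrix E = ∑ k, vecMulVec (E k).vec (star (E k).vec) := by
    ext x y
    simp [choiMatrix_apply, Matrix.sum_apply, vecMulVec_apply, vec]
  rw [h]
  exact Finset.sum_nonneg fun k _ => (posSemidef_vecMulVec_self_star _).nonneg

variable [Fintype B]

theorem trB_choiMatrix (E : κ → Matrix B A ℂ) :
    trB (choiMatrix E) = (∑ k, (E k)ᴴ * E k)ᵀ := by
  ext a a'
  simp only [trB, of_apply, choiMatrix_apply, transpose_apply, Matrix.sum_apply, mul_apply,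
    conjTranspose_apply]
  rw [Finset.sum_comm]
  simp only [mul_comm]

theorem choiProj_mul_choiMatrix [DecidableEq B] {K : Submodule ℂ (Matrix B A ℂ)}
    {E : κ → Matrix B A ℂ} (hE : ∀ k, E k ∈ K) : choiProj K * choiMatrix E = choiMatrix E := by
  refine mul_eq_self_of_forall_col_eq_vec (fun _ => choiProj_mulVec_vec) fun y =>
    ⟨∑ k, star (E k y.2 y.1) • E k, Submodule.sum_mem _ fun k _ => K.smul_mem _ (hE k), ?_⟩
  ext x
  simp [choiMatrix_apply, vec, Matrix.sum_apply, mul_comm]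

end ChoiMatrix

section BipartiteGraph

variable {A B : Type*} [DecidableEq A] [Fintype B] {K : Submodule ℂ (Matrix B A ℂ)}

theorem IsNCBipartiteGraph.nonempty [Nonempty A] (hK : IsNCBipartiteGraph K) : Nonempty B := by
  by_contra hB
  rw [not_nonempty_iff] at hB
  obtain ⟨r, E, hE, -⟩ := hK
  obtain ⟨a⟩ := ‹Nonempty A›
  have h := congrFun (congrFun hE a) a
  simp [Matrix.sum_apply, mul_apply] at h

theorem IsNCBipartiteGraph.one_le_trB [Fintype A] [DecidableEq B] (hK : IsNCBipartiteGraph K) :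
    1 ≤ trB ((Fintype.card A : ℝ) • choiProj K) := by
  obtain ⟨r, E, hE, rfl⟩ := hK
  set P := choiProj (Submodule.span ℂ (Set.range E))
  have hP : IsStarProjection P := isStarProjection_choiProj _
  have hPJ : P * choiMatrix E = choiMatrix E :=
    choiProj_mul_choiMatrix fun k => Submodule.subset_span ⟨k, rfl⟩
  have hJ : IsSelfAdjoint (choiMatrix E) := (choiMatrix_nonneg E).isSelfAdjoint
  have hJP : choiMatrix E * P = choiMatrix E := by
    simpa [hJ.star_eq, hP.isSelfAdjoint.star_eq] using congrArg star hPJ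
  have hB : trB (choiMatrix E) = 1 := by
    rw [trB_choiMatrix, show ∑ k, (E k)ᴴ * E k = 1 from hE, transpose_one]
  have htr : (choiMatrix E).trace.re = Fintype.card A := by
    have h := trace_mul_kronecker_one (choiMatrix E) 1
    rw [one_kronecker_one, Matrix.mul_one, Matrix.mul_one, hB, trace_one] at h
    rw [h, Complex.natCast_re]
  rw [← hB]
  refine trB_mono ?_
  have h := star_right_conjugate_le_conjugate (le_trace_smul_one (choiMatrix_nonneg E)) P
  rwa [hP.isSelfAdjoint.star_eq, hPJ, hJP, htr, Matrix.mul_smul, Matrix.mul_one,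
    Matrix.smul_mul, hP.isIdempotentElem.eq] at h

end BipartiteGraph

section ZeroErrorPair

variable {A B A' B' : Type*} [Fintype A] [Fintype B] [DecidableEq B]

/-- The constraints `0 ≤ U ≤ S ⊗ 𝟙` and `tr P (S ⊗ 𝟙 - U) = 0` that the semidefinite programs of
`upsilon` and `upsilonHat` have in common, for an arbitrary operator `P` in place of `choiProj K`.
The two programs differ in the further constraint on `trA U`. -/
structure IsZeroErrorPair (P : Matrix (A × B) (A × B) ℂ) (S : Matrix A A ℂ)
    (U : Matrix (A × B) (A × B) ℂ) : Prop where
  nonneg : 0 ≤ U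
  le : U ≤ S ⊗ₖ 1
  trace_eq_zero : (P * (S ⊗ₖ 1 - U)).trace = 0

namespace IsZeroErrorPair

variable {P U X : Matrix (A × B) (A × B) ℂ} {S : Matrix A A ℂ}

theorem kronecker_one (P : Matrix (A × B) (A × B) ℂ) (hS : 0 ≤ S) :
    IsZeroErrorPair P S (S ⊗ₖ 1) where
  nonneg := kronecker_nonneg hS zero_le_one
  le := le_rfl
  trace_eq_zero := by rw [sub_self, Matrix.mul_zero, trace_zero]

theorem left_nonneg [Nonempty B] (h : IsZeroErrorPair P S U) : 0 ≤ S := by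
  obtain ⟨b⟩ := ‹Nonempty B›
  have hsub : (S ⊗ₖ (1 : Matrix B B ℂ)).submatrix (·, b) (·, b) = S := by ext; simp
  rw [← hsub]
  exact ((h.nonneg.trans h.le).posSemidef.submatrix _).nonneg

theorem mul_kronecker_one (h : IsZeroErrorPair P S U) (hP : 0 ≤ P) (hX : X * P = X) :
    X * (S ⊗ₖ 1) = X * U := by
  have hzero : P * (S ⊗ₖ 1 - U) = 0 :=
    mul_eq_zero_of_trace_mul_eq_zero hP (sub_nonneg.2 h.le) h.trace_eq_zero
  rw [← sub_eq_zero, ← Matrix.mul_sub, ← hX, Matrix.mul_assoc, hzero, Matrix.mul_zero]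

theorem smul (h : IsZeroErrorPair P S U) {c : ℝ} (hc : 0 ≤ c) :
    IsZeroErrorPair P (c • S) (c • U) where
  nonneg := smul_nonneg hc h.nonneg
  le := by
    rw [smul_kronecker]
    exact smul_le_smul_of_nonneg_left h.le hc
  trace_eq_zero := by
    rw [smul_kronecker, ← smul_sub, Matrix.mul_smul, trace_smul, h.trace_eq_zero, smul_zero]

theorem mix (h : IsZeroErrorPair P S U) {x : ℝ} (hx0 : 0 ≤ x) (hx1 : x ≤ 1) :
    IsZeroErrorPair P S ((1 - x) • U + x • (S ⊗ₖ 1)) := by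
  have hsub : S ⊗ₖ (1 : Matrix B B ℂ) - ((1 - x) • U + x • (S ⊗ₖ 1)) =
      (1 - x) • (S ⊗ₖ 1 - U) := by module
  refine ⟨?_, ?_, ?_⟩
  · exact add_nonneg (smul_nonneg (sub_nonneg.2 hx1) h.nonneg)
      (smul_nonneg hx0 (h.nonneg.trans h.le))
  · rw [← sub_nonneg, hsub]
    exact smul_nonneg (sub_nonneg.2 hx1) (sub_nonneg.2 h.le)
  · rw [hsub, Matrix.mul_smul, trace_smul, h.trace_eq_zero, smul_zero]

theorem biPow {ι : Type*} [Fintype ι] [DecidableEq ι] (h : IsZeroErrorPair P S U) :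
    IsZeroErrorPair (biPow ι P) (piKronecker fun _ => S) (biPow ι U) where
  nonneg := biPow_nonneg h.nonneg
  le := by
    rw [← biPow_kronecker_one]
    exact biPow_mono h.nonneg h.le
  trace_eq_zero := by
    have htrace := h.trace_eq_zero
    rw [Matrix.mul_sub, trace_sub, sub_eq_zero] at htrace
    rw [← biPow_kronecker_one, Matrix.mul_sub, trace_sub, ← biPow_mul, ← biPow_mul, trace_biPow,
      trace_biPow, htrace, sub_self]

theorem submatrix [Fintype A'] [Fintype B'] [DecidableEq B'] (h : IsZeroErrorPair P S U)
    (e : A' ≃ A) (f : B' ≃ B) :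
    IsZeroErrorPair (P.submatrix (e.prodCongr f) (e.prodCongr f)) (S.submatrix e e)
      (U.submatrix (e.prodCongr f) (e.prodCongr f)) := by
  have hkron : S.submatrix e e ⊗ₖ (1 : Matrix B' B' ℂ) =
      (S ⊗ₖ (1 : Matrix B B ℂ)).submatrix (e.prodCongr f) (e.prodCongr f) := by
    rw [← submatrix_one_equiv f]; rfl
  refine ⟨(h.nonneg.posSemidef.submatrix _).nonneg, ?_, ?_⟩
  · rw [hkron]
    exact le_iff.2 ((le_iff.1 h.le).submatrix (e.prodCongr f))
  · have hsub : (S ⊗ₖ (1 : Matrix B B ℂ)).submatrix (e.prodCongr f) (e.prodCongr f) -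
        U.submatrix (e.prodCongr f) (e.prodCongr f) =
        (S ⊗ₖ 1 - U).submatrix (e.prodCongr f) (e.prodCongr f) := rfl
    rw [hkron, hsub, submatrix_mul_equiv, ← h.trace_eq_zero]
    exact Equiv.sum_comp (e.prodCongr f) (P * (S ⊗ₖ 1 - U)).diag

/-- Gluing in the range of the projection `P'` with the pair `(S, U)` and in its complement with
any `Y ≤ S ⊗ 𝟙`: the complement is invisible to `P ⊗ P'`. -/
theorem glue [Fintype A'] [DecidableEq A'] [Fintype B'] [DecidableEq B']
    (h : IsZeroErrorPair P S U) (hP : 0 ≤ P) {P' : Matrix (A' × B') (A' × B') ℂ}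
    (hP' : IsStarProjection P') {Y : Matrix ((A × A') × (B × B')) ((A × A') × (B × B')) ℂ}
    (hY0 : 0 ≤ Y) (hY : Y ≤ (S ⊗ₖ 1) ⊠ₖ (1 - P')) :
    IsZeroErrorPair (P ⊠ₖ P') (S ⊗ₖ 1) (U ⊠ₖ P' + Y) := by
  have hone : (S ⊗ₖ (1 : Matrix A' A' ℂ)) ⊗ₖ (1 : Matrix (B × B') (B × B') ℂ) =
      (S ⊗ₖ 1) ⊠ₖ P' + (S ⊗ₖ 1) ⊠ₖ (1 - P') := by
    rw [← biKronecker_add, add_sub_cancel, ← one_kronecker_one, ← one_kronecker_one,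
      kronecker_biKronecker_kronecker]
  have hsub : (S ⊗ₖ (1 : Matrix A' A' ℂ)) ⊗ₖ (1 : Matrix (B × B') (B × B') ℂ) -
      (U ⊠ₖ P' + Y) = (S ⊗ₖ 1 - U) ⊠ₖ P' + ((S ⊗ₖ 1) ⊠ₖ (1 - P') - Y) := by
    rw [hone, sub_biKronecker]; abel
  have hPP' : 0 ≤ P ⊠ₖ P' := biKronecker_nonneg hP hP'.nonneg
  refine ⟨add_nonneg (biKronecker_nonneg h.nonneg hP'.nonneg) hY0, ?_, ?_⟩
  · rw [hone]
    exact add_le_add (biKronecker_le_biKronecker_right h.le hP'.nonneg) hY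
  · have hle : (P ⊠ₖ P' * ((S ⊗ₖ 1) ⊠ₖ (1 - P') - Y)).trace ≤
        (P ⊠ₖ P' * ((S ⊗ₖ 1) ⊠ₖ (1 - P'))).trace :=
      trace_mul_le_trace_mul_left hPP' (sub_le_self _ hY0)
    rw [← biKronecker_mul, hP'.isIdempotentElem.mul_one_sub_self, trace_biKronecker, trace_zero,
      mul_zero] at hle
    rw [hsub, Matrix.mul_add, trace_add, ← biKronecker_mul, trace_biKronecker, h.trace_eq_zero,
      zero_mul, zero_add]
    exact hle.antisymm (trace_mul_nonneg hPP' (sub_nonneg.2 hY))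

end IsZeroErrorPair

end ZeroErrorPair

section TraceCompensator

variable {A B A' B' : Type*} [Fintype A'] [Fintype B'] [Fintype A] [Fintype B]

/-- `V` lives in the complement of the projection `P`, where it is bounded by `C`, and has the same
partial trace as `P`. Subtracting `τ ⊗ V` from `τ ⊗ P` makes the partial trace vanish. -/
structure IsTraceCompensator [DecidableEq A] [DecidableEq B]
    (P V : Matrix (A × B) (A × B) ℂ) (C : ℝ) : Prop where
  pos : 0 < C
  trA_eq : trA V = trA P
  neg_le : -(C • (1 - P)) ≤ V
  le : V ≤ C • (1 - P)

theorem exists_isTraceCompensator [DecidableEq A] [DecidableEq B]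
    {P Z : Matrix (A × B) (A × B) ℂ} (hP : IsStarProjection P)
    (hPZ : P * Z = 0) (hZP : Z * P = 0) (htrA : trA Z = trA P) :
    ∃ V C, IsTraceCompensator P V C := by
  have hPh : Pᴴ = P := hP.isSelfAdjoint
  set V := (2⁻¹ : ℝ) • (Z + Zᴴ) with hVdef
  have hV : V.IsHermitian := by
    rw [hVdef, IsHermitian, conjTranspose_smul, conjTranspose_add, conjTranspose_conjTranspose,
      star_trivial, add_comm]
  have hPV : P * V = 0 := by
    have h := congrArg conjTranspose hZP
    rw [conjTranspose_mul, hPh, conjTranspose_zero] at h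
    rw [Matrix.mul_smul, Matrix.mul_add, hPZ, h, add_zero, smul_zero]
  have hVP : V * P = 0 := by
    simpa [conjTranspose_mul, hV.eq, hPh] using congrArg conjTranspose hPV
  have hcompress : star (1 - P) * V * (1 - P) = V := by
    rw [hP.one_sub.isSelfAdjoint.star_eq, Matrix.sub_mul, hPV, Matrix.one_mul, sub_zero,
      Matrix.mul_sub, hVP, Matrix.mul_one, sub_zero]
  have hcompress_one : star (1 - P) * ((opNorm V + 1) • 1) * (1 - P) =
      (opNorm V + 1) • (1 - P) := by
    rw [hP.one_sub.isSelfAdjoint.star_eq, Matrix.mul_smul, Matrix.mul_one, Matrix.smul_mul,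
      hP.one_sub.isIdempotentElem.eq]
  have hnorm : opNorm V • (1 : Matrix (A × B) (A × B) ℂ) ≤ (opNorm V + 1) • 1 :=
    smul_le_smul_of_nonneg_right (le_add_of_nonneg_right zero_le_one) zero_le_one
  refine ⟨V, opNorm V + 1, ⟨add_pos_of_nonneg_of_pos (opNorm_nonneg V) one_pos, ?_, ?_, ?_⟩⟩
  · rw [trA_smul, trA_add, trA_conjTranspose, htrA, ← trA_conjTranspose, hPh]
    module
  · have h := star_left_conjugate_le_conjugate
      ((neg_le_neg hnorm).trans (neg_opNorm_smul_one_le hV)) (1 - P)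
    rwa [mul_neg, neg_mul, hcompress_one, hcompress] at h
  · have h := star_left_conjugate_le_conjugate ((le_opNorm_smul_one hV).trans hnorm) (1 - P)
    rwa [hcompress_one, hcompress] at h

theorem isStarProjection_biKronecker {P : Matrix (A × B) (A × B) ℂ}
    {P' : Matrix (A' × B') (A' × B') ℂ} (hP : IsStarProjection P) (hP' : IsStarProjection P') :
    IsStarProjection (P ⊠ₖ P') := by
  refine ⟨?_, ?_⟩
  · change P ⊠ₖ P' * P ⊠ₖ P' = P ⊠ₖ P'
    rw [← biKronecker_mul, hP.isIdempotentElem.eq, hP'.isIdempotentElem.eq]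
  · change (P ⊠ₖ P')ᴴ = P ⊠ₖ P'
    rw [biKronecker_conjTranspose, ← star_eq_conjTranspose, ← star_eq_conjTranspose,
      hP.isSelfAdjoint.star_eq, hP'.isSelfAdjoint.star_eq]

theorem exists_isTraceCompensator_biKronecker [DecidableEq A] [DecidableEq B] [DecidableEq A']
    [DecidableEq B'] {P : Matrix (A × B) (A × B) ℂ}
    {P' : Matrix (A' × B') (A' × B') ℂ} (hP : IsStarProjection P) (hP' : IsStarProjection P')
    (hQ : IsUnit (trA (1 - P))) (hQ' : IsUnit (trA (1 - P'))) :
    ∃ V C, IsTraceCompensator (P ⊠ₖ P') V C := by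
  -- Each factor of the complement is corrected to the partial trace of its projection, from a side
  -- on which this does not spoil the orthogonality to the product of the projections.
  set Z := ((1 - P) * ((1 : Matrix A A ℂ) ⊗ₖ ((trA (1 - P))⁻¹ * trA P))) ⊠ₖ
    (((1 : Matrix A' A' ℂ) ⊗ₖ (trA P' * (trA (1 - P'))⁻¹)) * (1 - P')) with hZ
  refine exists_isTraceCompensator (Z := Z) (isStarProjection_biKronecker hP hP') ?_ ?_ ?_
  · rw [hZ, ← biKronecker_mul, ← Matrix.mul_assoc, hP.isIdempotentElem.mul_one_sub_self,
      Matrix.zero_mul, zero_biKronecker]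
  · rw [hZ, ← biKronecker_mul, Matrix.mul_assoc _ (1 - P'),
      hP'.isIdempotentElem.one_sub_mul_self, Matrix.mul_zero, biKronecker_zero]
  · rw [hZ, trA_biKronecker, trA_biKronecker, trA_mul_one_kronecker, trA_one_kronecker_mul,
      ← Matrix.mul_assoc, mul_nonsing_inv _ ((isUnit_iff_isUnit_det _).1 hQ), Matrix.one_mul,
      Matrix.mul_assoc, nonsing_inv_mul _ ((isUnit_iff_isUnit_det _).1 hQ'), Matrix.mul_one]

namespace IsTraceCompensator

variable {A B A' B' : Type*} [Fintype A'] [DecidableEq A'] [DecidableEq B']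
  {P' V : Matrix (A' × B') (A' × B') ℂ} {C : ℝ}

theorem smul_biKronecker_mem_Icc [Finite A] [Finite B] [Fintype B']
    (hV : IsTraceCompensator P' V C) (hP' : IsStarProjection P') {σ τ : Matrix (A × B) (A × B) ℂ}
    (hτ : 0 ≤ τ) (hτσ : τ ≤ σ) {y : ℝ} (hy : 0 ≤ y) :
    y • (τ ⊠ₖ V) ∈ Set.Icc (-((y * C) • (σ ⊠ₖ (1 - P')))) ((y * C) • (σ ⊠ₖ (1 - P'))) := by
  cases nonempty_fintype A
  cases nonempty_fintype B
  have hτQ : (y * C) • (τ ⊠ₖ (1 - P')) ≤ (y * C) • (σ ⊠ₖ (1 - P')) :=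
    smul_le_smul_of_nonneg_left (biKronecker_le_biKronecker_right hτσ hP'.one_sub.nonneg)
      (mul_nonneg hy hV.pos.le)
  have hlower : τ ⊠ₖ (-C • (1 - P')) ≤ τ ⊠ₖ V :=
    biKronecker_le_biKronecker_left hτ (by rw [neg_smul]; exact hV.neg_le)
  have hupper : τ ⊠ₖ V ≤ τ ⊠ₖ (C • (1 - P')) := biKronecker_le_biKronecker_left hτ hV.le
  rw [biKronecker_smul] at hlower hupper
  constructor
  · refine (neg_le_neg hτQ).trans ?_
    have h := smul_le_smul_of_nonneg_left hlower hy
    rwa [smul_smul, mul_neg, neg_smul] at h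
  · refine le_trans ?_ hτQ
    have h := smul_le_smul_of_nonneg_left hupper hy
    rwa [smul_smul] at h

theorem smul_sub_smul_mem_Icc [Finite A] [Finite B] [Fintype B']
    (hV : IsTraceCompensator P' V C) (hP' : IsStarProjection P') {σ τ : Matrix (A × B) (A × B) ℂ}
    (hτ : 0 ≤ τ) (hτσ : τ ≤ σ) {x y : ℝ} (hy : 0 ≤ y) (hyx : y * C ≤ x) (hxy : x + y * C ≤ 1) :
    x • (σ ⊠ₖ (1 - P')) - y • (τ ⊠ₖ V) ∈ Set.Icc 0 (σ ⊠ₖ (1 - P')) := by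
  cases nonempty_fintype A
  cases nonempty_fintype B
  have hσQ : 0 ≤ σ ⊠ₖ (1 - P') := biKronecker_nonneg (hτ.trans hτσ) hP'.one_sub.nonneg
  obtain ⟨hlower, hupper⟩ := hV.smul_biKronecker_mem_Icc hP' hτ hτσ hy
  constructor
  · exact sub_nonneg.2 (hupper.trans (smul_le_smul_of_nonneg_right hyx hσQ))
  · calc x • (σ ⊠ₖ (1 - P')) - y • (τ ⊠ₖ V)
        ≤ x • (σ ⊠ₖ (1 - P')) + (y * C) • (σ ⊠ₖ (1 - P')) := by
          rw [sub_eq_add_neg]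
          exact add_le_add_right (_root_.neg_le.1 hlower) _
      _ = (x + y * C) • (σ ⊠ₖ (1 - P')) := (add_smul _ _ _).symm
      _ ≤ (1 : ℝ) • (σ ⊠ₖ (1 - P')) := smul_le_smul_of_nonneg_right hxy hσQ
      _ = σ ⊠ₖ (1 - P') := one_smul _ _

theorem trA_glue [Fintype A] [DecidableEq B] (hV : IsTraceCompensator P' V C) {S : Matrix A A ℂ}
    (U : Matrix (A × B) (A × B) ℂ) {s x y : ℝ} (hS : S.trace = s) (hys : y * s = 1 - x) :
    trA (((1 - x) • U + x • (S ⊗ₖ 1)) ⊠ₖ P' +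
      (x • ((S ⊗ₖ (1 : Matrix B B ℂ)) ⊠ₖ (1 - P')) - y • ((S ⊗ₖ trA U) ⊠ₖ V))) =
      (x * s * Fintype.card A') • 1 := by
  have hcancel : y • ((s : ℂ) • (trA U ⊗ₖ trA P')) = (1 - x) • (trA U ⊗ₖ trA P') := by
    rw [Complex.coe_smul, smul_smul, hys]
  rw [biKronecker_sub, trA_add, trA_sub, trA_smul, trA_smul, trA_sub]
  simp only [trA_biKronecker, trA_add, trA_smul, trA_kronecker, trA_one, hV.trA_eq, hS,
    add_kronecker, smul_kronecker, kronecker_smul, one_kronecker_one, hcancel]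
  module

end IsTraceCompensator

/-- With `C ≤ tr S`, the pair is first mixed with `S ⊗ 𝟙` in proportion `x = C / tr S`; then the
part of `tr_A U` that is left is compensated by `V` in the complement of `P'`, where the multiple
`x` of `S ⊗ 𝟙` ensures positivity. -/
theorem IsZeroErrorPair.exists_trA_eq_one [DecidableEq B] [DecidableEq A'] [DecidableEq B']
    [Nonempty A'] [Nonempty B]
    {P U : Matrix (A × B) (A × B) ℂ} {S : Matrix A A ℂ} (h : IsZeroErrorPair P S U) (hP : 0 ≤ P)
    (hU : trA U ≤ 1) {P' V : Matrix (A' × B') (A' × B') ℂ} {C : ℝ}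
    (hV : IsTraceCompensator P' V C) (hP' : IsStarProjection P') (hCS : C ≤ S.trace.re) :
    ∃ S' U', IsZeroErrorPair (P ⊠ₖ P') S' U' ∧ trA U' = 1 ∧ S'.trace.re = S.trace.re / C := by
  set s := S.trace.re
  set d := (Fintype.card A' : ℝ) with hd_def
  have hS : 0 ≤ S := h.left_nonneg
  have hstr : S.trace = (s : ℂ) := (ofReal_re_trace hS.posSemidef.isHermitian).symm
  have hC : 0 < C := hV.pos
  have hs : 0 < s := hC.trans_le hCS
  have hd : 0 < d := Nat.cast_pos.2 Fintype.card_pos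
  set x := C / s with hx
  have hxs : x * s = C := div_mul_cancel₀ C hs.ne'
  have hx0 : 0 ≤ x := div_nonneg hC.le hs.le
  have hx1 : x ≤ 1 := (div_le_one hs).2 hCS
  set y := (1 - x) / s with hy
  have hys : y * s = 1 - x := div_mul_cancel₀ _ hs.ne'
  have hyC : y * C = (1 - x) * x := by rw [hy, hx]; ring
  obtain ⟨hY0, hYQ⟩ := hV.smul_sub_smul_mem_Icc hP' (kronecker_nonneg hS (trA_nonneg h.nonneg))
    (kronecker_le_kronecker_left hS hU) (div_nonneg (sub_nonneg.2 hx1) hs.le)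
    (show y * C ≤ x by nlinarith only [hyC, hx0, hx1])
    (by nlinarith only [hyC, sq_nonneg (1 - x)])
  have htrA := hV.trA_glue U hstr hys
  rw [hxs] at htrA
  refine ⟨(C * d)⁻¹ • (S ⊗ₖ 1), _, ((h.mix hx0 hx1).glue hP hP' hY0 hYQ).smul (by positivity),
    ?_, ?_⟩
  · rw [trA_smul, htrA, inv_smul_smul₀ (mul_pos hC hd).ne']
  · rw [trace_smul, trace_kronecker, trace_one, hstr, ← Complex.ofReal_natCast,
      ← Complex.ofReal_mul, Complex.real_smul, Complex.re_ofReal_mul, Complex.ofReal_re, ← hd_def]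
    field_simp

end TraceCompensator

section Reindexing

/-- A word of length `n + 2`, split into its first `n` letters and the pair of its last two. -/
def splitLastTwo (A : Type*) (n : ℕ) : (Fin (n + 2) → A) ≃ (Fin n → A) × (A × A) :=
  (Fin.appendEquiv n 2).symm.trans ((Equiv.refl _).prodCongr (finTwoArrowEquiv A))

theorem biPow_biKronecker_submatrix_splitLastTwo {A B : Type*} (P : Matrix (A × B) (A × B) ℂ)
    (n : ℕ) :
    (biPow (Fin n) P ⊠ₖ (P ⊠ₖ P)).submatrix ((splitLastTwo A n).prodCongr (splitLastTwo B n))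
      ((splitLastTwo A n).prodCongr (splitLastTwo B n)) = biPow (Fin (n + 2)) P := by
  ext x y
  rw [biPow_apply, Fin.prod_univ_add, Fin.prod_univ_two]
  rfl

end Reindexing

section DualCertificate

variable {A B : Type*} [Fintype A] [DecidableEq A] [Fintype B]

/-- A feasible point of the semidefinite program dual to `packing` (for an arbitrary operator `P` in
place of `choiProj K`) for which `𝟙 ⊗ ω` commutes with `P`. The commutation makes `tr ω` an upper
bound for `upsilonHat` as well. -/
structure IsDualCertificate (P : Matrix (A × B) (A × B) ℂ) (ω : Matrix B B ℂ) : Prop where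
  nonneg : 0 ≤ ω
  commute : Commute (1 ⊗ₖ ω) P
  one_le : 1 ≤ trB (1 ⊗ₖ ω * P)

namespace IsDualCertificate

variable {P : Matrix (A × B) (A × B) ℂ} {ω : Matrix B B ℂ}

theorem trace_re_nonneg (hω : IsDualCertificate P ω) : 0 ≤ ω.trace.re :=
  (Complex.nonneg_iff.1 hω.nonneg.posSemidef.trace_nonneg).1

theorem mul_le (hω : IsDualCertificate P ω) (hP : IsStarProjection P) :
    1 ⊗ₖ ω * P ≤ 1 ⊗ₖ ω := by
  classical
  have h := star_left_conjugate_nonneg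
    (kronecker_nonneg (zero_le_one (α := Matrix A A ℂ)) hω.nonneg) (1 - P)
  rwa [hP.one_sub.isSelfAdjoint.star_eq, ← ((Commute.one_right _).sub_right hω.commute).eq,
    Matrix.mul_assoc, hP.one_sub.isIdempotentElem.eq, Matrix.mul_sub, Matrix.mul_one,
    sub_nonneg] at h

theorem biPow {ι : Type*} [Fintype ι] [DecidableEq ι] (hω : IsDualCertificate P ω) :
    IsDualCertificate (biPow ι P) (piKronecker fun _ : ι => ω) where
  nonneg := piKronecker_nonneg fun _ => hω.nonneg
  commute := by
    rw [Commute, SemiconjBy, ← one_kronecker_biPow, ← biPow_mul, ← biPow_mul, hω.commute.eq]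
  one_le := by
    rw [← one_kronecker_biPow, ← biPow_mul, trB_biPow, ← piKronecker_one]
    exact piKronecker_mono (fun _ => zero_le_one) fun _ => hω.one_le

variable [DecidableEq B] {S : Matrix A A ℂ}

theorem trace_le_trace_mul (hω : IsDualCertificate P ω) (hS : 0 ≤ S) :
    S.trace ≤ (1 ⊗ₖ ω * P * (S ⊗ₖ 1)).trace := by
  have h := trace_mul_le_trace_mul_right hω.one_le hS
  rwa [Matrix.one_mul, ← trace_mul_kronecker_one] at h

theorem trace_one_kronecker_mul_le (hω : IsDualCertificate P ω) {X : Matrix (A × B) (A × B) ℂ}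
    (hX : trA X ≤ 1) : ((1 ⊗ₖ ω) * X).trace ≤ ω.trace := by
  rw [← trace_trA, trA_one_kronecker_mul]
  simpa only [Matrix.mul_one] using trace_mul_le_trace_mul_left hω.nonneg hX

theorem trace_le_of_isZeroErrorPair [Nonempty B] (hω : IsDualCertificate P ω)
    (hP : IsStarProjection P) {U : Matrix (A × B) (A × B) ℂ} (h : IsZeroErrorPair P S U)
    (hU : trA U ≤ 1) : S.trace ≤ ω.trace :=
  calc S.trace ≤ (1 ⊗ₖ ω * P * (S ⊗ₖ 1)).trace := hω.trace_le_trace_mul h.left_nonneg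
    _ = (1 ⊗ₖ ω * P * U).trace := by
      rw [h.mul_kronecker_one hP.nonneg (by rw [Matrix.mul_assoc, hP.isIdempotentElem.eq])]
    _ ≤ (1 ⊗ₖ ω * U).trace := trace_mul_le_trace_mul_right (hω.mul_le hP) h.nonneg
    _ ≤ ω.trace := hω.trace_one_kronecker_mul_le hU

theorem trace_le_of_trA_mul_le_one (hω : IsDualCertificate P ω) (hS : 0 ≤ S)
    (h : trA (P * (S ⊗ₖ 1)) ≤ 1) : S.trace ≤ ω.trace :=
  calc S.trace ≤ (1 ⊗ₖ ω * P * (S ⊗ₖ 1)).trace := hω.trace_le_trace_mul hS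
    _ = (1 ⊗ₖ ω * (P * (S ⊗ₖ 1))).trace := by rw [Matrix.mul_assoc]
    _ ≤ ω.trace := hω.trace_one_kronecker_mul_le h

end IsDualCertificate

theorem IsNCBipartiteGraph.exists_isDualCertificate [DecidableEq B]
    {K : Submodule ℂ (Matrix B A ℂ)} (hK : IsNCBipartiteGraph K) :
    ∃ ω, IsDualCertificate (choiProj K) ω := by
  refine ⟨(Fintype.card A : ℝ) • 1, smul_nonneg (Nat.cast_nonneg _) zero_le_one, ?_, ?_⟩ <;>
    rw [kronecker_smul, one_kronecker_one]
  · exact (Commute.one_left _).smul_left _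
  · rw [Matrix.smul_mul, Matrix.one_mul]
    exact hK.one_le_trB

end DualCertificate

theorem le_of_eventually_natCast_mul_sub_le {a b c k : ℝ}
    (h : ∀ᶠ n : ℕ in Filter.atTop, n * a - b ≤ (n + k) * c) : a ≤ c := by
  by_contra! hca
  have hgrow : Filter.Tendsto (fun n : ℕ => (n : ℝ) * (a - c)) Filter.atTop Filter.atTop :=
    tendsto_natCast_atTop_atTop.atTop_mul_const (sub_pos.2 hca)
  obtain ⟨n, hn, hlarge⟩ := (h.and (hgrow.eventually_gt_atTop (b + k * c))).exists
  linarith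

section Values

variable {A B : Type*} [Fintype A] [Fintype B] [DecidableEq B]

theorem exists_isZeroErrorPair_trace_re_eq_one [Nonempty A] (P : Matrix (A × B) (A × B) ℂ) :
    ∃ S U, IsZeroErrorPair P S U ∧ trA U = 1 ∧ S.trace.re = 1 := by
  classical
  have htr : ((Fintype.card A : ℝ)⁻¹ • (1 : Matrix A A ℂ)).trace = 1 := by
    rw [trace_smul, trace_one, ← Complex.ofReal_natCast, Complex.real_smul, ← Complex.ofReal_mul,
      inv_mul_cancel₀ (Nat.cast_ne_zero.2 Fintype.card_ne_zero), Complex.ofReal_one]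
  refine ⟨(Fintype.card A : ℝ)⁻¹ • 1, _,
    .kronecker_one P (smul_nonneg (by positivity) zero_le_one), ?_, ?_⟩
  · rw [trA_kronecker, htr, one_smul]
  · rw [htr, Complex.one_re]

variable [DecidableEq A] {K : Submodule ℂ (Matrix B A ℂ)} {ω : Matrix B B ℂ}

theorem upsilon_eq_sSup (K : Submodule ℂ (Matrix B A ℂ)) :
    upsilon K = sSup {t : ℝ | ∃ S U, IsZeroErrorPair (choiProj K) S U ∧ trA U = 1 ∧
      t = S.trace.re} := by
  refine congrArg sSup (Set.ext fun t => ?_)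
  exact ⟨fun ⟨S, U, hU, hSU, htrA, hPSU, ht⟩ => ⟨S, U, ⟨hU.nonneg, hSU, hPSU⟩, htrA, ht⟩,
    fun ⟨S, U, h, htrA, ht⟩ => ⟨S, U, h.nonneg.posSemidef, h.le, htrA, h.trace_eq_zero, ht⟩⟩

theorem upsilonHat_eq_sSup (K : Submodule ℂ (Matrix B A ℂ)) :
    upsilonHat K = sSup {t : ℝ | ∃ S U, IsZeroErrorPair (choiProj K) S U ∧ trA U ≤ 1 ∧
      t = S.trace.re} := by
  refine congrArg sSup (Set.ext fun t => ?_)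
  exact ⟨fun ⟨S, U, hU, hSU, htrA, hPSU, ht⟩ => ⟨S, U, ⟨hU.nonneg, hSU, hPSU⟩, htrA, ht⟩,
    fun ⟨S, U, h, htrA, ht⟩ => ⟨S, U, h.nonneg.posSemidef, h.le, htrA, h.trace_eq_zero, ht⟩⟩

theorem packing_eq_sSup (K : Submodule ℂ (Matrix B A ℂ)) :
    packing K = sSup {t : ℝ | ∃ S, 0 ≤ S ∧ trA (choiProj K * (S ⊗ₖ 1)) ≤ 1 ∧
      t = S.trace.re} := by
  simp only [packing, nonneg_iff_posSemidef]
  rfl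

namespace IsDualCertificate

theorem packing_le (hω : IsDualCertificate (choiProj K) ω) : packing K ≤ ω.trace.re := by
  rw [packing_eq_sSup]
  refine Real.sSup_le ?_ hω.trace_re_nonneg
  rintro _ ⟨S, hS, hle, rfl⟩
  exact (Complex.le_def.1 (hω.trace_le_of_trA_mul_le_one hS hle)).1

variable [Nonempty B]

theorem upsilonHat_le (hω : IsDualCertificate (choiProj K) ω) : upsilonHat K ≤ ω.trace.re := by
  rw [upsilonHat_eq_sSup]
  refine Real.sSup_le ?_ hω.trace_re_nonneg
  rintro _ ⟨S, U, h, hle, rfl⟩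
  exact (Complex.le_def.1
    (hω.trace_le_of_isZeroErrorPair (isStarProjection_choiProj K) h hle)).1

theorem trace_re_le_pow (hω : IsDualCertificate (choiProj K) ω) {n : ℕ}
    {S : Matrix (Fin n → A) (Fin n → A) ℂ} {U}
    (h : IsZeroErrorPair (choiProj (tensorPow K n)) S U) (hU : trA U ≤ 1) :
    S.trace.re ≤ ω.trace.re ^ n := by
  have hωn : IsDualCertificate (choiProj (tensorPow K n)) (piKronecker fun _ : Fin n => ω) := by
    rw [choiProj_tensorPow]
    exact hω.biPow
  have hle := (Complex.le_def.1
    (hωn.trace_le_of_isZeroErrorPair (isStarProjection_choiProj _) h hU)).1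
  rwa [trace_piKronecker, Finset.prod_const, Finset.card_univ, Fintype.card_fin,
    ← ofReal_re_trace hω.nonneg.posSemidef.isHermitian, ← Complex.ofReal_pow,
    Complex.ofReal_re] at hle

theorem upsilon_tensorPow_le (hω : IsDualCertificate (choiProj K) ω) (n : ℕ) :
    upsilon (tensorPow K n) ≤ ω.trace.re ^ n := by
  rw [upsilon_eq_sSup]
  refine Real.sSup_le ?_ (pow_nonneg hω.trace_re_nonneg n)
  rintro _ ⟨S, U, h, hU, rfl⟩
  exact hω.trace_re_le_pow h hU.le

end IsDualCertificate

namespace IsNCBipartiteGraph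

theorem trace_re_le_packing (hK : IsNCBipartiteGraph K) {S : Matrix A A ℂ} (hS : 0 ≤ S)
    (hle : trA (choiProj K * (S ⊗ₖ 1)) ≤ 1) : S.trace.re ≤ packing K := by
  obtain ⟨ω, hω⟩ := hK.exists_isDualCertificate
  rw [packing_eq_sSup]
  refine le_csSup ⟨ω.trace.re, ?_⟩ ⟨S, hS, hle, rfl⟩
  rintro _ ⟨S, hS, hle, rfl⟩
  exact (Complex.le_def.1 (hω.trace_le_of_trA_mul_le_one hS hle)).1

variable [Nonempty A]

theorem trace_re_le_upsilonHat (hK : IsNCBipartiteGraph K) {S : Matrix A A ℂ} {U}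
    (h : IsZeroErrorPair (choiProj K) S U) (hU : trA U ≤ 1) : S.trace.re ≤ upsilonHat K := by
  have := hK.nonempty
  obtain ⟨ω, hω⟩ := hK.exists_isDualCertificate
  rw [upsilonHat_eq_sSup]
  refine le_csSup ⟨ω.trace.re, ?_⟩ ⟨S, U, h, hU, rfl⟩
  rintro _ ⟨S, U, h, hU, rfl⟩
  exact (Complex.le_def.1
    (hω.trace_le_of_isZeroErrorPair (isStarProjection_choiProj K) h hU)).1

theorem trace_re_le_upsilon_tensorPow (hK : IsNCBipartiteGraph K) {n : ℕ}
    {S : Matrix (Fin n → A) (Fin n → A) ℂ} {U}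
    (h : IsZeroErrorPair (choiProj (tensorPow K n)) S U) (hU : trA U = 1) :
    S.trace.re ≤ upsilon (tensorPow K n) := by
  have := hK.nonempty
  obtain ⟨ω, hω⟩ := hK.exists_isDualCertificate
  rw [upsilon_eq_sSup]
  refine le_csSup ⟨ω.trace.re ^ n, ?_⟩ ⟨S, U, h, hU, rfl⟩
  rintro _ ⟨S, U, h, hU, rfl⟩
  exact hω.trace_re_le_pow h hU.le

theorem one_le_upsilonHat (hK : IsNCBipartiteGraph K) : 1 ≤ upsilonHat K := by
  obtain ⟨S, U, h, hU, hS⟩ := exists_isZeroErrorPair_trace_re_eq_one (choiProj K)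
  rw [← hS]
  exact hK.trace_re_le_upsilonHat h hU.le

theorem one_le_upsilon_tensorPow (hK : IsNCBipartiteGraph K) (n : ℕ) :
    1 ≤ upsilon (tensorPow K n) := by
  obtain ⟨S, U, h, hU, hS⟩ := exists_isZeroErrorPair_trace_re_eq_one (choiProj (tensorPow K n))
  rw [← hS]
  exact hK.trace_re_le_upsilon_tensorPow h hU

theorem one_div_mul_logb_upsilon_le (hK : IsNCBipartiteGraph K)
    (hω : IsDualCertificate (choiProj K) ω) {n : ℕ} (hn : 1 ≤ n) :
    (1 / (n : ℝ)) * Real.logb 2 (upsilon (tensorPow K n)) ≤ Real.logb 2 ω.trace.re := by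
  have := hK.nonempty
  rw [one_div, inv_mul_le_iff₀ (Nat.cast_pos.2 hn), ← Real.logb_pow]
  exact Real.logb_le_logb_of_le one_lt_two (one_pos.trans_le (hK.one_le_upsilon_tensorPow n))
    (hω.upsilon_tensorPow_le n)

theorem capacity_le (hK : IsNCBipartiteGraph K) (hω : IsDualCertificate (choiProj K) ω) :
    capacity K ≤ Real.logb 2 ω.trace.re := by
  refine csSup_le ⟨_, 1, le_rfl, rfl⟩ ?_
  rintro _ ⟨n, hn, rfl⟩
  exact hK.one_div_mul_logb_upsilon_le hω hn

theorem logb_upsilon_le (hK : IsNCBipartiteGraph K) {n : ℕ} (hn : 1 ≤ n) :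
    Real.logb 2 (upsilon (tensorPow K n)) ≤ n * capacity K := by
  obtain ⟨ω, hω⟩ := hK.exists_isDualCertificate
  rw [← inv_mul_le_iff₀ (Nat.cast_pos.2 hn), ← one_div]
  refine le_csSup ⟨Real.logb 2 ω.trace.re, ?_⟩ ⟨n, hn, rfl⟩
  rintro _ ⟨n, hn, rfl⟩
  exact hK.one_div_mul_logb_upsilon_le hω hn

theorem capacity_nonneg (hK : IsNCBipartiteGraph K) : 0 ≤ capacity K := by
  have h := (Real.logb_nonneg one_lt_two (hK.one_le_upsilon_tensorPow 1)).trans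
    (hK.logb_upsilon_le le_rfl)
  rwa [Nat.cast_one, one_mul] at h

theorem pow_div_le_upsilon (hK : IsNCBipartiteGraph K) {S : Matrix A A ℂ} {U}
    (h : IsZeroErrorPair (choiProj K) S U) (hU : trA U ≤ 1) {V} {C : ℝ}
    (hV : IsTraceCompensator (choiProj K ⊠ₖ choiProj K) V C) {n : ℕ} (hn : C ≤ S.trace.re ^ n) :
    S.trace.re ^ n / C ≤ upsilon (tensorPow K (n + 2)) := by
  have := hK.nonempty
  have hP := isStarProjection_choiProj K
  have htr : (piKronecker fun _ : Fin n => S).trace.re = S.trace.re ^ n := by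
    rw [trace_piKronecker, Finset.prod_const, Finset.card_univ, Fintype.card_fin,
      ← ofReal_re_trace h.left_nonneg.posSemidef.isHermitian, ← Complex.ofReal_pow,
      Complex.ofReal_re, Complex.ofReal_re]
  have hUn : trA (biPow (Fin n) U) ≤ 1 := by
    rw [trA_biPow, ← piKronecker_one]
    exact piKronecker_mono (fun _ => trA_nonneg h.nonneg) fun _ => hU
  rw [← htr] at hn ⊢
  obtain ⟨S', U', h', hU', htr'⟩ := h.biPow.exists_trA_eq_one (biPow_nonneg hP.nonneg) hUn hV
    (isStarProjection_biKronecker hP hP) hn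
  have hword := h'.submatrix (splitLastTwo A n) (splitLastTwo B n)
  rw [biPow_biKronecker_submatrix_splitLastTwo, ← choiProj_tensorPow] at hword
  have htrS : (S'.submatrix (splitLastTwo A n) (splitLastTwo A n)).trace = S'.trace :=
    Equiv.sum_comp (splitLastTwo A n) S'.diag
  rw [← htr', ← htrS]
  refine hK.trace_re_le_upsilon_tensorPow hword ?_
  rw [trA_submatrix, hU', submatrix_one_equiv]

/-- If `tr_A (𝟙 - P)` is invertible, two additional uses of the channel suffice to restore
`tr_A U = 𝟙`, at a cost independent of the number of uses. -/
theorem logb_trace_re_le_capacity (hK : IsNCBipartiteGraph K)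
    (hQ : IsUnit (trA (1 - choiProj K))) {S : Matrix A A ℂ} {U}
    (h : IsZeroErrorPair (choiProj K) S U) (hU : trA U ≤ 1) (hS : 1 < S.trace.re) :
    Real.logb 2 S.trace.re ≤ capacity K := by
  have hP := isStarProjection_choiProj K
  obtain ⟨V, C, hV⟩ := exists_isTraceCompensator_biKronecker hP hP hQ hQ
  refine le_of_eventually_natCast_mul_sub_le (b := Real.logb 2 C) (k := 2) ?_
  filter_upwards [(tendsto_pow_atTop_atTop_of_one_lt hS).eventually_ge_atTop C] with n hn
  have hpos : 0 < S.trace.re ^ n := pow_pos (one_pos.trans hS) n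
  have hle := hK.logb_upsilon_le (n := n + 2) (Nat.le_add_left 1 (n + 1))
  push_cast at hle
  rw [← Real.logb_pow, ← Real.logb_div hpos.ne' hV.pos.ne']
  exact (Real.logb_le_logb_of_le one_lt_two (div_pos hpos hV.pos)
    (hK.pow_div_le_upsilon h hU hV hn)).trans hle

end IsNCBipartiteGraph

end Values

section Degenerate

variable {A B : Type*} [Fintype A] [DecidableEq A] [Fintype B] [DecidableEq B]

/-- If `v` spans part of the kernel of `tr_A (𝟙 - P)`, then `A ⊗ ℂ v` lies in the range of `P`, so
the projection onto `ℂ v` satisfies the constraints with equality. -/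
theorem exists_isDualCertificate_trace_eq_one {P : Matrix (A × B) (A × B) ℂ}
    (hP : IsStarProjection P) (h : ¬(trA (1 - P)).PosDef) :
    ∃ ω, IsDualCertificate P ω ∧ ω.trace = 1 := by
  have hQ : 0 ≤ 1 - P := hP.one_sub.nonneg
  rw [(trA_nonneg hQ).posSemidef.posDef_iff_isUnit, isUnit_iff_isUnit_det, isUnit_iff_ne_zero,
    not_not] at h
  obtain ⟨v, hv, hker⟩ := exists_mulVec_eq_zero_iff.2 h
  have hr : 0 < star v ⬝ᵥ v := dotProduct_star_self_pos_iff.2 hv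
  set ω := (star v ⬝ᵥ v)⁻¹ • vecMulVec v (star v) with hωdef
  have hω : 0 ≤ ω := ((posSemidef_vecMulVec_self_star v).smul (inv_nonneg.2 hr.le)).nonneg
  have htr : ω.trace = 1 := by
    rw [trace_smul, trace_vecMulVec, dotProduct_comm v, smul_eq_mul, inv_mul_cancel₀ hr.ne']
  have hzero : (1 - P) * (1 ⊗ₖ ω) = 0 := by
    refine mul_eq_zero_of_trace_mul_eq_zero hQ (kronecker_nonneg zero_le_one hω) ?_
    rw [← trace_trA, trA_mul_one_kronecker, hωdef, Matrix.mul_smul, mul_vecMulVec, hker,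
      zero_vecMulVec, smul_zero, trace_zero]
  have hleft : P * (1 ⊗ₖ ω) = 1 ⊗ₖ ω := by
    rwa [Matrix.sub_mul, Matrix.one_mul, sub_eq_zero, eq_comm] at hzero
  have hright : 1 ⊗ₖ ω * P = 1 ⊗ₖ ω := by
    have hstar := congrArg star hleft
    rwa [star_mul, hP.isSelfAdjoint.star_eq,
      (kronecker_nonneg (zero_le_one (α := Matrix A A ℂ)) hω).isSelfAdjoint.star_eq] at hstar
  refine ⟨ω, ⟨hω, hright.trans hleft.symm, ?_⟩, htr⟩
  rw [hright, trB_kronecker, htr, one_smul]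

variable {K : Submodule ℂ (Matrix B A ℂ)}

theorem posDef_of_one_lt_packing (h : 1 < packing K) : (trA (1 - choiProj K)).PosDef := by
  by_contra hsing
  obtain ⟨ω, hω, htr⟩ :=
    exists_isDualCertificate_trace_eq_one (isStarProjection_choiProj K) hsing
  have hle := hω.packing_le
  rw [htr, Complex.one_re] at hle
  exact hle.not_gt h

theorem posDef_of_one_lt_upsilonHat [Nonempty B] (h : 1 < upsilonHat K) :
    (trA (1 - choiProj K)).PosDef := by
  by_contra hsing
  obtain ⟨ω, hω, htr⟩ :=
    exists_isDualCertificate_trace_eq_one (isStarProjection_choiProj K) hsing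
  have hle := hω.upsilonHat_le
  rw [htr, Complex.one_re] at hle
  exact hle.not_gt h

theorem IsNCBipartiteGraph.posDef_of_capacity_pos [Nonempty A] (hK : IsNCBipartiteGraph K)
    (h : 0 < capacity K) : (trA (1 - choiProj K)).PosDef := by
  by_contra hsing
  obtain ⟨ω, hω, htr⟩ :=
    exists_isDualCertificate_trace_eq_one (isStarProjection_choiProj K) hsing
  have hle := hK.capacity_le hω
  rw [htr, Complex.one_re, Real.logb_one] at hle
  exact hle.not_gt h

theorem IsNCBipartiteGraph.logb_upsilonHat_le_capacity [Nonempty A] (hK : IsNCBipartiteGraph K) :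
    Real.logb 2 (upsilonHat K) ≤ capacity K := by
  have := hK.nonempty
  rcases hK.one_le_upsilonHat.eq_or_lt with hone | hone
  · rw [← hone, Real.logb_one]
    exact hK.capacity_nonneg
  have hQ : IsUnit (trA (1 - choiProj K)) := (posDef_of_one_lt_upsilonHat hone).isUnit
  rw [Real.logb_le_iff_le_rpow one_lt_two (one_pos.trans hone), upsilonHat_eq_sSup]
  refine Real.sSup_le ?_ (Real.rpow_nonneg zero_le_two _)
  rintro _ ⟨S, U, h, hU, rfl⟩
  rcases le_or_gt S.trace.re 1 with hS | hS
  · exact hS.trans (Real.one_le_rpow one_le_two hK.capacity_nonneg)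
  · exact (Real.logb_le_iff_le_rpow one_lt_two (one_pos.trans hS)).1
      (hK.logb_trace_re_le_capacity hQ h hU hS)

end Degenerate

section OutputNorm

variable {A B : Type*} [Fintype A] [DecidableEq A] [Fintype B] [DecidableEq B]
  {K : Submodule ℂ (Matrix B A ℂ)}

theorem inv_opNorm_smul_le_one {X : Matrix B B ℂ} (hX : X.IsHermitian) (hpos : 0 < opNorm X) :
    (opNorm X)⁻¹ • X ≤ 1 := by
  have h := smul_le_smul_of_nonneg_left (le_opNorm_smul_one hX) (inv_nonneg.2 hpos.le)
  rwa [inv_smul_smul₀ hpos.ne'] at h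

theorem trace_re_smul_one (c : ℝ) : (c • (1 : Matrix B B ℂ)).trace.re = Fintype.card B * c := by
  rw [trace_smul, trace_one, Complex.smul_re, Complex.natCast_re, smul_eq_mul, mul_comm]

theorem trA_choiProj_isHermitian (K : Submodule ℂ (Matrix B A ℂ)) :
    (trA (choiProj K)).IsHermitian :=
  (trA_nonneg (isStarProjection_choiProj K).nonneg).posSemidef.isHermitian

namespace IsNCBipartiteGraph

variable [Nonempty A]

theorem opNorm_pos (hK : IsNCBipartiteGraph K) : 0 < opNorm (trA (choiProj K)) := by
  refine (opNorm_nonneg _).lt_of_ne' fun hzero => ?_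
  have htr : (choiProj K * 1).trace = 0 := by
    rw [Matrix.mul_one, ← trace_trA, opNorm_eq_zero.1 hzero, trace_zero]
  have hP : choiProj K = 0 := by
    rw [← Matrix.mul_one (choiProj K)]
    exact mul_eq_zero_of_trace_mul_eq_zero (isStarProjection_choiProj K).nonneg zero_le_one htr
  have hle := hK.one_le_trB
  rw [hP, smul_zero, trB_zero] at hle
  exact one_ne_zero (hle.antisymm zero_le_one)

theorem div_opNorm_le_upsilonHat (hK : IsNCBipartiteGraph K) :
    (Fintype.card A : ℝ) / opNorm (trA (choiProj K)) ≤ upsilonHat K := by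
  have hP := isStarProjection_choiProj K
  have hN : 0 ≤ (opNorm (trA (choiProj K)))⁻¹ := inv_nonneg.2 hK.opNorm_pos.le
  have hpair : IsZeroErrorPair (choiProj K) (1 : Matrix A A ℂ) (choiProj K) :=
    ⟨hP.nonneg, by simpa only [one_kronecker_one] using hP.le_one, by
      rw [one_kronecker_one, Matrix.mul_sub, Matrix.mul_one, hP.isIdempotentElem.eq, sub_self,
        trace_zero]⟩
  rw [div_eq_mul_inv, ← trace_re_smul_one]
  refine hK.trace_re_le_upsilonHat (hpair.smul hN) ?_
  rw [trA_smul]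
  exact inv_opNorm_smul_le_one (trA_choiProj_isHermitian K) hK.opNorm_pos

theorem div_opNorm_le_packing (hK : IsNCBipartiteGraph K) :
    (Fintype.card A : ℝ) / opNorm (trA (choiProj K)) ≤ packing K := by
  rw [div_eq_mul_inv, ← trace_re_smul_one]
  refine hK.trace_re_le_packing
    (smul_nonneg (inv_nonneg.2 hK.opNorm_pos.le) zero_le_one) ?_
  rw [smul_kronecker, one_kronecker_one, Matrix.mul_smul, Matrix.mul_one, trA_smul]
  exact inv_opNorm_smul_le_one (trA_choiProj_isHermitian K) hK.opNorm_pos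

theorem one_lt_div_opNorm (hK : IsNCBipartiteGraph K) (h : (trA (1 - choiProj K)).PosDef) :
    1 < (Fintype.card A : ℝ) / opNorm (trA (choiProj K)) := by
  obtain ⟨c, hc, hle⟩ := exists_pos_smul_one_le h
  have hmin : 0 < min c 1 := lt_min hc one_pos
  have hcard : (1 : ℝ) ≤ Fintype.card A := Nat.one_le_cast.2 Fintype.card_pos
  have hsmul : min c 1 • 1 ≤ (Fintype.card A : ℝ) • 1 - trA (choiProj K) := by
    rw [Nat.cast_smul_eq_nsmul, ← Nat.cast_smul_eq_nsmul ℂ, ← trA_one, ← trA_sub]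
    exact (smul_le_smul_of_nonneg_right (min_le_left c 1) zero_le_one).trans hle
  have hnorm : opNorm (trA (choiProj K)) ≤ Fintype.card A - min c 1 := by
    rw [opNorm_le_iff (trA_nonneg (isStarProjection_choiProj K).nonneg)
      (sub_nonneg.2 ((min_le_right c 1).trans hcard)), sub_smul]
    exact le_sub_comm.1 hsmul
  rw [one_lt_div hK.opNorm_pos]
  linarith

end IsNCBipartiteGraph

end OutputNorm

section CqGraph

variable {M B : Type*} [DecidableEq M]

/-- The block-diagonal operator `∑ m, |m⟩⟨m| ⊗ R m`; Mathlib's `blockDiagonal` has the block index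
in the second factor. -/
def cqBlock (R : M → Matrix B B ℂ) : Matrix (M × B) (M × B) ℂ :=
  (blockDiagonal R).submatrix Prod.swap Prod.swap

theorem cqBlock_isHermitian {R : M → Matrix B B ℂ} (hR : ∀ m, (R m).IsHermitian) :
    (cqBlock R).IsHermitian := by
  rw [IsHermitian, cqBlock, conjTranspose_submatrix, blockDiagonal_conjTranspose]
  simp only [(hR _).eq]

theorem cqBlock_col (R : M → Matrix B B ℂ) (y : M × B) :
    (cqBlock R).col y = (vecMulVec ((R y.1).col y.2) (Pi.single y.1 1)).vec := by
  ext x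
  by_cases h : x.1 = y.1 <;> simp [cqBlock, blockDiagonal_apply, vec, vecMulVec_apply, h]

variable [Fintype M] [Fintype B]

theorem cqBlock_mulVec_vec (R : M → Matrix B B ℂ) (m : M) (v : B → ℂ) :
    cqBlock R *ᵥ (vecMulVec v (Pi.single m 1)).vec =
      (vecMulVec (R m *ᵥ v) (Pi.single m 1)).vec := by
  ext x
  by_cases h : x.1 = m <;>
    simp [mulVec, dotProduct, cqBlock, blockDiagonal_apply, Fintype.sum_prod_type, vec,
      vecMulVec_apply, Pi.single_apply, h]

theorem trA_cqBlock_mul_kronecker_one [DecidableEq B] (R : M → Matrix B B ℂ) (S : Matrix M M ℂ) :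
    trA (cqBlock R * (S ⊗ₖ (1 : Matrix B B ℂ))) = ∑ m, S m m • R m := by
  ext b b'
  simp [trA, mul_apply, cqBlock, blockDiagonal_apply, Fintype.sum_prod_type, Matrix.sum_apply,
    one_apply, mul_comm]

theorem choiProj_cqGraph [DecidableEq B] {V : M → Submodule ℂ (B → ℂ)} {R : M → Matrix B B ℂ}
    (hR : ∀ m, (R m).IsHermitian) (hfix : ∀ m, ∀ v ∈ V m, R m *ᵥ v = v)
    (hcol : ∀ m b, (R m).col b ∈ V m) : choiProj (cqGraph V) = cqBlock R := by
  refine choiProj_eq (cqBlock_isHermitian hR) (fun F hF => ?_) fun y => ?_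
  · induction hF using Submodule.span_induction with
    | mem F hF =>
      obtain ⟨m, v, hv, rfl⟩ := hF
      rw [cqBlock_mulVec_vec, hfix m v hv]
    | zero => rw [vec_zero, mulVec_zero]
    | add F G _ _ hF hG => rw [vec_add, mulVec_add, hF, hG]
    | smul c F _ hF => rw [vec_smul, mulVec_smul, hF]
  · exact ⟨_, Submodule.subset_span ⟨y.1, _, hcol y.1 y.2, rfl⟩, (cqBlock_col R y).symm⟩

end CqGraph

section CodingGraph

theorem conjTranspose_mul_self_kronecker_one {A A' B : Type*} [Fintype A'] [Fintype B]
    [DecidableEq A] [DecidableEq B] {U : Matrix A' A ℂ} (hU : Uᴴ * U = 1) :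
    (U ⊗ₖ (1 : Matrix B B ℂ))ᴴ * (U ⊗ₖ (1 : Matrix B B ℂ)) = 1 := by
  rw [conjTranspose_kronecker, ← mul_kronecker_mul, hU, conjTranspose_one, Matrix.one_mul,
    one_kronecker_one]

variable {M A A' B : Type*} [Fintype A] [Fintype B] [DecidableEq B]

theorem trA_kronecker_one_conj [Fintype A'] [DecidableEq A] {U : Matrix A' A ℂ}
    (hU : Uᴴ * U = 1) (X : Matrix (A × B) (A × B) ℂ) :
    trA ((U ⊗ₖ (1 : Matrix B B ℂ)) * X * (U ⊗ₖ (1 : Matrix B B ℂ))ᴴ) = trA X := by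
  rw [conjTranspose_kronecker, conjTranspose_one, trA_mul_kronecker_one_comm, ← Matrix.mul_assoc,
    ← mul_kronecker_mul, hU, Matrix.one_mul, one_kronecker_one, Matrix.one_mul]

theorem sum_kronecker_one_conj [Fintype M] [DecidableEq A'] {U : M → Matrix A' A ℂ} {r : ℂ}
    (hU : ∀ X : Matrix A A ℂ, ∑ m, U m * X * (U m)ᴴ = (r * X.trace) • (1 : Matrix A' A' ℂ))
    (X : Matrix (A × B) (A × B) ℂ) :
    ∑ m, (U m ⊗ₖ (1 : Matrix B B ℂ)) * X * (U m ⊗ₖ (1 : Matrix B B ℂ))ᴴ =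
      r • ((1 : Matrix A' A' ℂ) ⊗ₖ trA X) := by
  ext x y
  have hentry (m : M) :
      ((U m ⊗ₖ (1 : Matrix B B ℂ)) * X * (U m ⊗ₖ (1 : Matrix B B ℂ))ᴴ) x y =
        (U m * X.submatrix (·, x.2) (·, y.2) * (U m)ᴴ) x.1 y.1 := by
    simp [mul_apply, Fintype.sum_prod_type, one_apply, apply_ite (starRingEnd ℂ)]
  rw [Matrix.sum_apply, Finset.sum_congr rfl fun m _ => hentry m, ← Matrix.sum_apply, hU]
  simp only [trA, trace, diag_apply, submatrix_apply, Matrix.smul_apply, kroneckerMap_apply,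
    of_apply, smul_eq_mul]
  ring

/-- The cq-graph of the cq-channel with inputs `m : M` whose output `m` is supported on
`U m ⊗ 𝟙` applied to the support of the Choi-Jamiołkowski matrix. For isometries `U m` this is
coding with shared entanglement; the Pauli matrices give `superdenseGraph`. -/
def codingGraph [DecidableEq M] (U : M → Matrix A' A ℂ) (K : Submodule ℂ (Matrix B A ℂ)) :
    Submodule ℂ (Matrix (A' × B) M ℂ) :=
  cqGraph fun m => Submodule.span ℂ {v | ∃ E ∈ K, v = (U m ⊗ₖ (1 : Matrix B B ℂ)) *ᵥ E.vec}

variable [Fintype M] [DecidableEq M] [DecidableEq A] [Fintype A'] [DecidableEq A']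
  {U : M → Matrix A' A ℂ} {K : Submodule ℂ (Matrix B A ℂ)}

theorem choiProj_codingGraph (hU : ∀ m, (U m)ᴴ * U m = 1) :
    choiProj (codingGraph U K) = cqBlock fun m =>
      (U m ⊗ₖ (1 : Matrix B B ℂ)) * choiProj K * (U m ⊗ₖ (1 : Matrix B B ℂ))ᴴ := by
  refine choiProj_cqGraph (fun m => ?_) (fun m v hv => ?_) fun m b => ?_
  · exact isHermitian_mul_mul_conjTranspose _
      (isStarProjection_choiProj K).isSelfAdjoint.isHermitian
  · induction hv using Submodule.span_induction with
    | mem v hv =>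
      obtain ⟨E, hE, rfl⟩ := hv
      rw [mulVec_mulVec, Matrix.mul_assoc, conjTranspose_mul_self_kronecker_one (hU m),
        Matrix.mul_one, ← mulVec_mulVec, choiProj_mulVec_vec hE]
    | zero => rw [mulVec_zero]
    | add v w _ _ hv hw => rw [mulVec_add, hv, hw]
    | smul c v _ hv => rw [mulVec_smul, hv]
  · obtain ⟨E, hE, hvec⟩ :=
      exists_mem_vec_eq_choiProj_mulVec K ((U m ⊗ₖ (1 : Matrix B B ℂ))ᴴ.col b)
    refine Submodule.subset_span ⟨E, hE, ?_⟩
    rw [hvec, mulVec_mulVec, ← mulVec_single_one, ← mulVec_single_one, mulVec_mulVec]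

/-- The partial trace over `A'` does not see the isometries. -/
theorem trace_re_mul_opNorm_le_card (hU : ∀ m, (U m)ᴴ * U m = 1) {S : Matrix M M ℂ} (hS : 0 ≤ S)
    (h : trA (choiProj (codingGraph U K) * (S ⊗ₖ 1)) ≤ 1) :
    S.trace.re * opNorm (trA (choiProj K)) ≤ Fintype.card A' := by
  have htr : 0 ≤ S.trace.re := (Complex.nonneg_iff.1 hS.posSemidef.trace_nonneg).1
  have hmono := trA_mono h
  rw [choiProj_codingGraph hU, trA_cqBlock_mul_kronecker_one, trA_sum_smul, trA_one] at hmono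
  simp only [trA_kronecker_one_conj (hU _)] at hmono
  rw [← Finset.sum_smul] at hmono
  change S.trace • _ ≤ _ at hmono
  rw [← ofReal_re_trace hS.posSemidef.isHermitian, Complex.coe_smul,
    ← Complex.ofReal_natCast, Complex.coe_smul,
    ← opNorm_le_iff (smul_nonneg htr (trA_nonneg (isStarProjection_choiProj K).nonneg))
      (Nat.cast_nonneg _), opNorm_smul, abs_of_nonneg htr] at hmono
  exact hmono

theorem packing_codingGraph [Nonempty M] [Nonempty A'] (hU : ∀ m, (U m)ᴴ * U m = 1)
    (htwirl : ∀ X : Matrix A A ℂ, ∑ m, U m * X * (U m)ᴴ =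
      (Fintype.card M / Fintype.card A' * X.trace) • (1 : Matrix A' A' ℂ))
    (hN : 0 < opNorm (trA (choiProj K))) :
    packing (codingGraph U K) = Fintype.card A' / opNorm (trA (choiProj K)) := by
  set N := opNorm (trA (choiProj K))
  have hM : (Fintype.card M : ℝ) ≠ 0 := Nat.cast_ne_zero.2 Fintype.card_ne_zero
  have hA' : (Fintype.card A' : ℝ) ≠ 0 := Nat.cast_ne_zero.2 Fintype.card_ne_zero
  rw [packing_eq_sSup]
  refine IsGreatest.csSup_eq ⟨⟨(Fintype.card A' / (Fintype.card M * N)) • 1,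
    smul_nonneg (by positivity) zero_le_one, ?_, ?_⟩, ?_⟩
  · rw [choiProj_codingGraph hU, trA_cqBlock_mul_kronecker_one]
    have hscale : ((Fintype.card A' / (Fintype.card M * N) : ℝ) : ℂ) *
        (Fintype.card M / Fintype.card A') = ((N⁻¹ : ℝ) : ℂ) := by
      rw [← Complex.ofReal_natCast, ← Complex.ofReal_natCast, ← Complex.ofReal_div,
        ← Complex.ofReal_mul]
      congr 1
      field_simp
    simp only [Matrix.smul_apply, one_apply_eq, Complex.real_smul, mul_one]
    rw [← Finset.smul_sum, sum_kronecker_one_conj htwirl, smul_smul, hscale, Complex.coe_smul,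
      ← kronecker_smul, ← one_kronecker_one]
    exact kronecker_le_kronecker_left zero_le_one
      (inv_opNorm_smul_le_one (trA_choiProj_isHermitian K) hN)
  · rw [trace_re_smul_one]
    field_simp
  · rintro _ ⟨S, hS, hle, rfl⟩
    exact (le_div_iff₀ hN).2 (trace_re_mul_opNorm_le_card hU hS hle)

end CodingGraph

section Pauli

variable {d : ℕ} [NeZero d]

/-- The primitive `d`-th root of unity `exp (2πi / d)` occurring in the generalized Pauli
matrices. -/
def pauliRoot (d : ℕ) : ℂ := Complex.exp (2 * Real.pi * Complex.I / d)

theorem isPrimitiveRoot_pauliRoot : IsPrimitiveRoot (pauliRoot d) d :=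
  Complex.isPrimitiveRoot_exp d (NeZero.ne d)

theorem star_pauliRoot_pow_mul_self (j : ℕ) : star (pauliRoot d ^ j) * pauliRoot d ^ j = 1 := by
  have hnorm : ‖pauliRoot d ^ j‖ = 1 := by
    rw [norm_pow, isPrimitiveRoot_pauliRoot.norm'_eq_one (NeZero.ne d), one_pow]
  rw [Complex.star_def, ← Complex.inv_eq_conj hnorm,
    inv_mul_cancel₀ (norm_ne_zero_iff.1 (hnorm ▸ one_ne_zero))]

theorem pauli_apply (m : Fin d × Fin d) (a' a : Fin d) :
    pauli d m a' a = if a' = a + m.1 then pauliRoot d ^ ((m.2 : ℕ) * (a : ℕ)) else 0 := by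
  rw [pauli, of_apply, pauliRoot, ← Complex.exp_nat_mul]
  congr 2
  push_cast
  ring

theorem sum_pauliRoot_pow_mul_star (a c : Fin d) :
    ∑ k : Fin d, pauliRoot d ^ ((k : ℕ) * (a : ℕ)) * star (pauliRoot d ^ ((k : ℕ) * (c : ℕ))) =
      if a = c then (d : ℂ) else 0 := by
  have hζ := isPrimitiveRoot_pauliRoot (d := d)
  set w := pauliRoot d ^ (a : ℕ) * star (pauliRoot d ^ (c : ℕ)) with hw
  have hterm (k : Fin d) : pauliRoot d ^ ((k : ℕ) * (a : ℕ)) *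
      star (pauliRoot d ^ ((k : ℕ) * (c : ℕ))) = w ^ (k : ℕ) := by
    rw [hw, mul_pow, ← star_pow, ← pow_mul', ← pow_mul']
  rw [Finset.sum_congr rfl fun k _ => hterm k, Fin.sum_univ_eq_sum_range (w ^ ·)]
  split_ifs with hac
  · have hw1 : w = 1 := by rw [hw, hac, mul_comm, star_pauliRoot_pow_mul_self]
    simp only [hw1, one_pow, Finset.sum_const, Finset.card_range, nsmul_eq_mul, mul_one]
  · have hw1 : w ≠ 1 := fun h => hac <| Fin.ext <| hζ.pow_inj a.2 c.2 <| by
      rw [← mul_one (pauliRoot d ^ (a : ℕ)), ← star_pauliRoot_pow_mul_self (d := d) (c : ℕ),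
        ← mul_assoc, ← hw, h, one_mul]
    have hwd : w ^ d = 1 := by
      rw [hw, mul_pow, ← star_pow, ← pow_mul', ← pow_mul', pow_mul, pow_mul, hζ.pow_eq_one,
        one_pow, one_pow, star_one, mul_one]
    rw [geom_sum_eq hw1, hwd, sub_self, zero_div]

theorem pauli_conjTranspose_mul_self (m : Fin d × Fin d) : (pauli d m)ᴴ * pauli d m = 1 := by
  ext a c
  simp only [mul_apply, conjTranspose_apply, pauli_apply, mul_ite, mul_zero, Finset.sum_ite_eq',
    Finset.mem_univ, if_true, add_left_inj, one_apply, apply_ite star, star_zero, ite_mul,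
    zero_mul, eq_comm (a := c)]
  refine if_ctx_congr Iff.rfl (fun h => ?_) fun _ => rfl
  rw [h, star_pauliRoot_pow_mul_self]

theorem pauli_conj_apply (X : Matrix (Fin d) (Fin d) ℂ) (m : Fin d × Fin d) (a c : Fin d) :
    (pauli d m * X * (pauli d m)ᴴ) a c = X (a - m.1) (c - m.1) *
      (pauliRoot d ^ ((m.2 : ℕ) * ((a - m.1 : Fin d) : ℕ)) *
        star (pauliRoot d ^ ((m.2 : ℕ) * ((c - m.1 : Fin d) : ℕ)))) := by
  have hshift (x y : Fin d) : x = y + m.1 ↔ y = x - m.1 :=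
    eq_comm.trans eq_sub_iff_add_eq.symm
  simp only [mul_apply, conjTranspose_apply, pauli_apply, hshift, apply_ite star, star_zero,
    mul_ite, mul_zero, ite_mul, zero_mul, Finset.sum_ite_eq', Finset.mem_univ, if_true]
  ring

theorem sum_pauli_conj (X : Matrix (Fin d) (Fin d) ℂ) :
    ∑ m, pauli d m * X * (pauli d m)ᴴ = ((d : ℂ) * X.trace) • 1 := by
  ext a c
  simp only [Matrix.sum_apply, pauli_conj_apply, Fintype.sum_prod_type, ← Finset.mul_sum,
    sum_pauliRoot_pow_mul_star, sub_left_inj, Matrix.smul_apply, one_apply, smul_eq_mul, mul_ite,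
    mul_one, mul_zero]
  split_ifs with h
  · rw [h, ← Finset.sum_mul, mul_comm]
    exact congrArg _ (Equiv.sum_comp (Equiv.subLeft c) X.diag)
  · exact Finset.sum_const_zero

theorem packing_superdenseGraph {B : Type*} [Fintype B] [DecidableEq B]
    {K : Submodule ℂ (Matrix B (Fin d) ℂ)} (hK : IsNCBipartiteGraph K) :
    packing (superdenseGraph K) = (d : ℝ) / opNorm (trA (choiProj K)) := by
  have hcard : (Fintype.card (Fin d × Fin d) : ℂ) / Fintype.card (Fin d) = d := by
    rw [Fintype.card_prod, Fintype.card_fin, Nat.cast_mul,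
      mul_div_cancel_right₀ _ (NeZero.ne (d : ℂ))]
  have h := packing_codingGraph (K := K) (U := pauli d) pauli_conjTranspose_mul_self
    (hcard ▸ sum_pauli_conj) hK.opNorm_pos
  rwa [Fintype.card_fin] at h

end Pauli

end NoSignalling

end

open NoSignalling in
theorem mainTheorem10 (dA dB : ℕ) [NeZero dA]
    (K : Submodule ℂ (Matrix (Fin dB) (Fin dA) ℂ)) (hK : IsNCBipartiteGraph K) :
    List.TFAE [
      0 < capacity K,
      1 < packing K,
      ((dA : ℂ) • (1 : Matrix (Fin dB) (Fin dB) ℂ) - trA (choiProj K)).PosDef,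
      (trA (1 - choiProj K)).PosDef,
      1 < upsilonHat K] ∧
    Real.logb 2 (upsilonHat K) ≤ capacity K ∧
    (dA : ℝ) / opNorm (trA (choiProj K)) ≤ upsilonHat K ∧
    Real.logb 2 ((dA : ℝ) / opNorm (trA (choiProj K))) ≤ Real.logb 2 (upsilonHat K) ∧
    (dA : ℝ) / opNorm (trA (choiProj K)) ≤ packing K ∧
    packing (superdenseGraph K) = (dA : ℝ) / opNorm (trA (choiProj K)) := by
  have hcap := hK.logb_upsilonHat_le_capacity
  have hhat := hK.div_opNorm_le_upsilonHat
  have hpack := hK.div_opNorm_le_packing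
  have hone := hK.one_lt_div_opNorm
  rw [Fintype.card_fin] at hhat hpack hone
  have htr : trA (1 - choiProj K) = (dA : ℂ) • 1 - trA (choiProj K) := by
    rw [trA_sub, trA_one, Fintype.card_fin]
  have hratio : 0 < (dA : ℝ) / opNorm (trA (choiProj K)) :=
    div_pos (Nat.cast_pos.2 (NeZero.pos dA)) hK.opNorm_pos
  refine ⟨?_, hcap, hhat, Real.logb_le_logb_of_le one_lt_two hratio hhat, hpack,
    packing_superdenseGraph hK⟩
  rw [← htr]
  tfae_have 1 → 3 := hK.posDef_of_capacity_pos
  tfae_have 2 → 3 := posDef_of_one_lt_packing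
  tfae_have 3 → 2 := fun h => (hone h).trans_le hpack
  tfae_have 3 ↔ 4 := Iff.rfl
  tfae_have 3 → 5 := fun h => (hone h).trans_le hhat
  tfae_have 5 → 1 := fun h => (Real.logb_pos one_lt_two h).trans_le hcap
  tfae_finish
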